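/- A non-commutative $*$-probability space $(\mathcal A,\varphi)$ is a unital complex $*$-algebra $\mathcal A$ with a complex linear functional $\varphi$ (the state) such that $\varphi(1)=1$. Variables $\{a_{n,j}\}_{1\le j\le k}$ in $(\mathcal A_n,\varphi_n)$ converge (jointly) in $*$-distribution to $\{a_j\}_{1\le j\le k}$ in $(\mathcal A,\varphi)$ if $\lim_{n\to\infty}\varphi_n(Q(a_{n,1},\dots,a_{n,k}))=\varphi(Q(a_1,\dots,a_k))$ for every monomial $Q$ in non-commuting indeterminates $x_1,x_1^*,\dots,x_k,x_k^*$. Let $\mathcal M_n$ be the $*$-algebra of $n\times n$ complex random matrices (on a given probability space) all of whose entries have finite moments of all orders, with state $\varphi_n=n^{-1}\,\mathbb E\,\mathrm{Tr}$. A self-adjoint variable $a$ is a (unit variance) symmetrized Rayleigh variable if $\varphi(a^{2m-1})=0$ and $\varphi(a^{2m})=m!$ for all integers $m\ge1$; these are the moments of the density $|x|e^{-x^2}$ on $\mathbb R$. Variables $\{b_j\}$ are independent if they commute and $\varphi\big(\prod_{j\in F} b_j^{p_j}b_j^{*q_j}\big)=\prod_{j\in F}\varphi\big(b_j^{p_j}b_j^{*q_j}\big)$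 for all finite sets $F$ of indices and all integers $p_j,q_j\ge0$. Variables $\{a_j\}$ half commute if $a_ia_ja_k=a_ka_ja_i$ for all $i,j,k$. A monomial $a_{j_1}\cdots a_{j_m}$ is symmetric if each index occurs equally often at odd and at even positions. Variables $\{a_j\}$ are half-independent if they half commute, the variables $\{a_j^2\}$ are independent, and $\varphi(Q)=0$ for every non-symmetric monomial $Q$ in $\{a_j\}$. The $n\times n$ left skew-circulant matrix with real inputs $l_0,\dots,l_{n-1}$ is $L_n=(L_n(i,j))_{0\le i,j\le n-1}$ with $L_n(i,j)=l_{i+j}$ if $i+j<n$ and $L_n(i,j)=-l_{i+j-n}$ if $i+j\ge n$. **Theorem.** Let $k\in\mathbb N$. For each $n\ge1$ let $L_n^{(1)},\dots,L_n^{(k)}$ be independent random $n\times n$ left skew-circulant matrices with inputs $(l^{(j)}_{n,i})_{0\le i<n}$, $1\le j\le k$. Assume that for each $j$ the inputs satisfy Assumption I: for each $n$ the real random variables $l^{(j)}_{n,0},\dots,l^{(j)}_{n,n-1}$ are independent with mean $0$ and variance $1$, and for every $p\in\mathbb N$, $\sup_{n,i}\mathbb E|l^{(j)}_{n,i}|^p<\infty$.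 Then $\{n^{-1/2}L_n^{(j)}\}_{1\le j\le k}$, as elements of $(\mathcal M_n,\varphi_n)$, converge jointly in $*$-distribution, as $n\to\infty$, to a family $\{a_j\}_{1\le j\le k}$ of half-independent self-adjoint variables in some non-commutative $*$-probability space, each $a_j$ being a symmetrized Rayleigh variable of unit variance. -/

import Mathlib

open MeasureTheory ProbabilityTheory Filter Topology
open scoped ENNReal

noncomputable section

/-! ### Non-commutative `*`-probability spaces -/

/-- A state on a unital complex `*`-algebra `A`: a complex linear functional `φ` with `φ 1 = 1`.
The pair `(A, φ)` is a non-commutative `*`-probability space. -/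
structure NCState (A : Type*) [Ring A] [StarRing A] [Algebra ℂ A] [StarModule ℂ A] where
  toLinearMap : A →ₗ[ℂ] ℂ
  map_one' : toLinearMap 1 = 1

instance {A : Type*} [Ring A] [StarRing A] [Algebra ℂ A] [StarModule ℂ A] :
    CoeFun (NCState A) (fun _ => A → ℂ) :=
  ⟨fun φ => φ.toLinearMap⟩

/-- Value at `(a_i)` of a monomial in the non-commuting indeterminates `x_i, x_i^*`; the letter
`(i, false)` stands for `x_i` and the letter `(i, true)` for `x_i^*`. -/
def evalStarMonomial {ι A : Type*} [Ring A] [StarRing A] (a : ι → A) (Q : List (ι × Bool)) : A :=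
  (Q.map fun x => if x.2 then star (a x.1) else a x.1).prod

/-- Joint convergence in `*`-distribution of the families `(a n i)_i` in `(A n, φ n)`, `n ≥ 1`, to
the family `(b i)_i` in `(B, ψ)`. -/
def ConvergesInStarDistribution {ι : Type*} {A : ℕ+ → Type*} [∀ n, Ring (A n)]
    [∀ n, StarRing (A n)] [∀ n, Algebra ℂ (A n)] [∀ n, StarModule ℂ (A n)]
    (φ : ∀ n, NCState (A n)) (a : ∀ n, ι → A n)
    {B : Type*} [Ring B] [StarRing B] [Algebra ℂ B] [StarModule ℂ B]
    (ψ : NCState B) (b : ι → B) : Prop :=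
  ∀ Q : List (ι × Bool),
    Tendsto (fun n => φ n (evalStarMonomial (a n) Q)) atTop (𝓝 (ψ (evalStarMonomial b Q)))

section Variables

variable {ι A : Type*} [Ring A] [StarRing A] [Algebra ℂ A] [StarModule ℂ A]

/-- (Standard) symmetrized Rayleigh variable; its variance is `φ (a ^ 2) = 1! = 1`. -/
structure IsSymmetrizedRayleigh (φ : NCState A) (a : A) : Prop where
  selfAdjoint : IsSelfAdjoint a
  odd_moment : ∀ m : ℕ, 1 ≤ m → φ (a ^ (2 * m - 1)) = 0
  even_moment : ∀ m : ℕ, 1 ≤ m → φ (a ^ (2 * m)) = (m.factorial : ℂ)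

/-- (Mutual) independence of a family of variables: they commute and the `*`-moments of finitely
many distinct members of the family factorize. -/
structure NCIndependent (φ : NCState A) (a : ι → A) : Prop where
  commute : ∀ i j, Commute (a i) (a j)
  factorize : ∀ (s : List ι), s.Nodup → ∀ p q : ι → ℕ,
    φ (s.map fun j => a j ^ p j * star (a j) ^ q j).prod =
      (s.map fun j => φ (a j ^ p j * star (a j) ^ q j)).prod

/-- The variables `(a_j)` half commute. -/
def HalfCommute (a : ι → A) : Prop :=
  ∀ i j k, a i * a j * a k = a k * a j * a i

/-- The monomial `a_{w 0} a_{w 1} ⋯ a_{w (m - 1)}` is symmetric: each index occurs equally often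
at odd and at even positions. -/
def IsSymmetricWord {m : ℕ} (w : Fin m → ι) : Prop :=
  ∀ j, Nat.card {r : Fin m // w r = j ∧ Odd (r : ℕ)} =
    Nat.card {r : Fin m // w r = j ∧ Even (r : ℕ)}

/-- Half-independence of a family of variables. -/
structure HalfIndependent (φ : NCState A) (a : ι → A) : Prop where
  halfCommute : HalfCommute a
  indep_sq : NCIndependent φ (fun j => a j ^ 2)
  nonsymmetric : ∀ (m : ℕ) (w : Fin m → ι), ¬ IsSymmetricWord w →
    φ (List.ofFn fun r => a (w r)).prod = 0

end Variables

/-! ### The space of random matrices with finite moments -/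

section RandomMatrices

variable {Ω : Type*} [MeasurableSpace Ω] (P : Measure Ω) [IsProbabilityMeasure P]

/-- The `*`-algebra of complex random variables with finite moments of all orders. -/
def momentAlgebra : StarSubalgebra ℂ (Ω → ℂ) where
  carrier := {f | ∀ p : ℝ≥0∞, p ≠ ∞ → MemLp f p P}
  mul_mem' := by
    intro f g hf hg p hp
    have h2 : p * 2 ≠ ∞ := ENNReal.mul_ne_top hp (by norm_num)
    have : ENNReal.HolderTriple (p * 2) (p * 2) p := by
      constructor
      rcases eq_or_ne p 0 with rfl | h0
      · simp
      · rw [ENNReal.mul_inv (Or.inl h0) (Or.inl hp), ← mul_add, ENNReal.inv_two_add_inv_two,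
          mul_one]
    exact (hg _ h2).mul (hf _ h2)
  add_mem' := fun hf hg p hp => (hf p hp).add (hg p hp)
  algebraMap_mem' := fun c p _ => memLp_const c
  star_mem' := fun hf p hp => (hf p hp).star

/-- The `*`-algebra of `n × n` random matrices, all whose entries have finite moments of all
orders; the involution is the conjugate transpose. -/
abbrev RandomMatrix (n : ℕ) : Type _ := Matrix (Fin n) (Fin n) (momentAlgebra P)

/-- The expectation as a linear functional on the random variables with finite moments. -/
def expectation : momentAlgebra P →ₗ[ℂ] ℂ where
  toFun f := ∫ ω, (f : Ω → ℂ) ω ∂P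
  map_add' f g := integral_add (memLp_one_iff_integrable.1 (f.2 1 (by simp)))
    (memLp_one_iff_integrable.1 (g.2 1 (by simp)))
  map_smul' c f := integral_const_mul c _

/-- The state `n⁻¹ 𝔼 Tr` on the `n × n` random matrices. -/
def expectedTrace (n : ℕ+) : NCState (RandomMatrix P n) where
  toLinearMap := ((n : ℕ) : ℂ)⁻¹ • (expectation P ∘ₗ Matrix.traceLinearMap (Fin n) ℂ _)
  map_one' := by
    have h1 : expectation P 1 = 1 := by simp [expectation]
    have hn : ((n : ℕ) : ℂ) ≠ 0 := by simp
    have h2 : ((n : ℕ) : momentAlgebra P) = ((n : ℕ) : ℂ) • (1 : momentAlgebra P) := by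
      rw [Nat.cast_smul_eq_nsmul, nsmul_eq_mul, mul_one]
    rw [LinearMap.smul_apply, LinearMap.comp_apply, Matrix.traceLinearMap_apply, Matrix.trace_one,
      Fintype.card_fin, h2, map_smul, h1, smul_eq_mul, smul_eq_mul, mul_one, inv_mul_cancel₀ hn]

end RandomMatrices

/-! ### Left skew-circulant matrices -/

/-- The left skew-circulant matrix `LScirc(l_0, …, l_{n-1})`. -/
def leftSkewCirculant {R : Type*} [Neg R] {n : ℕ} (l : Fin n → R) : Matrix (Fin n) (Fin n) R :=
  Matrix.of fun i j =>
    if h : (i : ℕ) + j < n then l ⟨i + j, h⟩ else -l ⟨i + j - n, by omega⟩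

/-- Real inputs `x n 0, …, x n (n - 1)` of the `n × n` matrices, `n ≥ 1`: for each `n` independent,
with zero mean and unit variance, and with moments of any order bounded uniformly in all of the
inputs. -/
structure AssumptionI {Ω : ℕ+ → Type*} [∀ n, MeasurableSpace (Ω n)] (P : ∀ n, Measure (Ω n))
    (x : ∀ n : ℕ+, Fin n → Ω n → ℝ) : Prop where
  measurable : ∀ n i, Measurable (x n i)
  indep : ∀ n, iIndepFun (x n) (P n)
  mean_zero : ∀ n i, ∫ ω, x n i ω ∂(P n) = 0
  unit_variance : ∀ n i, variance (x n i) (P n) = 1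
  bounded_moments : ∀ p : ℕ, ∃ C : ℝ, ∀ n i,
    Integrable (fun ω => |x n i ω| ^ p) (P n) ∧ ∫ ω, |x n i ω| ^ p ∂(P n) ≤ C

section Input

variable {Ω : ℕ+ → Type*} [∀ n, MeasurableSpace (Ω n)] {P : ∀ n, Measure (Ω n)}
  [∀ n, IsProbabilityMeasure (P n)] {x : ∀ n : ℕ+, Fin n → Ω n → ℝ}

theorem AssumptionI.mem_momentAlgebra (h : AssumptionI P x) (n : ℕ+) (i : Fin n) :
    (fun ω => (x n i ω : ℂ)) ∈ momentAlgebra (P n) := by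
  intro p hp
  obtain ⟨N, hN⟩ := ENNReal.exists_nat_gt hp
  have hN0 : N ≠ 0 := by rintro rfl; simp at hN
  obtain ⟨C, hC⟩ := h.bounded_moments N
  have hm : AEStronglyMeasurable (x n i) (P n) := (h.measurable n i).aestronglyMeasurable
  have h1 : MemLp (x n i) N (P n) := by
    rw [← integrable_norm_rpow_iff hm (by exact_mod_cast hN0) (by simp)]
    simpa using (hC n i).1
  exact (h1.ofReal (K := ℂ)).mono_exponent hN.le

/-- The left skew-circulant random matrix built from the `n`-th row of inputs. -/
def AssumptionI.leftSkewCirculant (h : AssumptionI P x) (n : ℕ+) : RandomMatrix (P n) n :=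
  _root_.leftSkewCirculant fun i => ⟨fun ω => (x n i ω : ℂ), h.mem_momentAlgebra n i⟩

end Input

end

open scoped ComplexConjugate

/-! ### Taylor estimates for the monomials `y ^ p * z ^ q` -/

/-! If `a ^ n = -1`, the row vector `v_a = (a ^ i)_i` satisfies `v_a L = λ(a) v_{a⁻¹}` with `λ(a) =
∑ l_s a ^ s`: a left skew-circulant matrix acts by a scalar and exchanges `a` with `a⁻¹`. A word in
such matrices therefore multiplies `v_a` by an alternating product of values `λ_j(a)` and
`λ_j(a⁻¹)`. The `n` roots of `-1` give a Fourier basis, so the trace is a sum of these products over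
the roots (`trace_prod_leftSkewCirculant`). For words of odd length only a root with `a ^ 2 = 1`
contributes, that is `a = -1`, and it disappears after division by `n`.

The inputs are real and `|a| = 1`, so `λ_j(a⁻¹) = conj λ_j(a)`. By independence over `j`, each root
contributes a product of mixed moments `𝔼 Z ^ p * conj Z ^ q`, where `Z = n^{-1/2} ∑ l_s a ^ s` and
`p`, `q` count the even and odd positions of the letter `j`. If `a ^ 2 ≠ 1`, the weights `c_s`
satisfy `∑ c_s ^ 2 = 0` and `∑ |c_s| ^ 2 = 1`, so `Z` is nearly a standard complex Gaussian,
uniformly in the root. This is proved by approximate integration by parts, whose moment recursion `m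
(p + 1) q ≈ q * m p (q - 1)` has error `O(n^{-1/2})`
(`exists_norm_integral_mixedPow_sub_gaussian_le`).

The limit is realized by the matrices `!![0, z_j; conj z_j, 0]` with independent Gaussian `z_j`:
they exchange two coordinates just as `L` exchanges `a` and `a⁻¹`, and produce the same alternating
products (`rayleighState_prod`). -/

theorem norm_add_pow_sub_pow_le {y v : ℂ} {B : ℝ} (hB : 1 + ‖y‖ + ‖v‖ ≤ B) (p : ℕ) :
    ‖(y + v) ^ p - y ^ p‖ ≤ p * ‖v‖ * B ^ p := by
  have hy := norm_nonneg y
  have hv := norm_nonneg v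
  have hB0 : 0 ≤ B := by linarith
  induction p with
  | zero => simp
  | succ p ih =>
    have e : (y + v) ^ (p + 1) - y ^ (p + 1) = ((y + v) ^ p - y ^ p) * (y + v) + v * y ^ p := by
      ring
    have h1 : ‖y + v‖ ≤ B := (norm_add_le _ _).trans (by linarith)
    have h2 : ‖y ^ p‖ ≤ B ^ p * B := by
      rw [norm_pow]
      calc ‖y‖ ^ p ≤ B ^ p := by gcongr; linarith
        _ ≤ B ^ p * B := le_mul_of_one_le_right (by positivity) (by linarith)
    calc _ ≤ ‖((y + v) ^ p - y ^ p) * (y + v)‖ + ‖v * y ^ p‖ := e ▸ norm_add_le _ _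
      _ ≤ (p * ‖v‖ * B ^ p) * B + ‖v‖ * (B ^ p * B) := by
        rw [norm_mul, norm_mul]; gcongr
      _ = _ := by push_cast; ring

theorem norm_add_pow_sub_pow_sub_le {y v : ℂ} {B : ℝ} (hB : 1 + ‖y‖ + ‖v‖ ≤ B) (p : ℕ) :
    ‖(y + v) ^ p - y ^ p - p * v * y ^ (p - 1)‖ ≤ p ^ 2 * ‖v‖ ^ 2 * B ^ p := by
  have hy := norm_nonneg y
  have hv := norm_nonneg v
  have hB0 : 0 ≤ B := by linarith
  induction p with
  | zero => simp
  | succ p ih =>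
    have e0 : (p : ℂ) * (y ^ (p - 1) * y) = p * y ^ p := by
      cases p with
      | zero => simp
      | succ p => simp [pow_succ]
    have e : (y + v) ^ (p + 1) - y ^ (p + 1) - (p + 1 : ℕ) * v * y ^ (p + 1 - 1) =
        ((y + v) ^ p - y ^ p - p * v * y ^ (p - 1)) * y + ((y + v) ^ p - y ^ p) * v := by
      push_cast [Nat.add_sub_cancel]
      linear_combination v * e0
    have h1 : ‖y‖ ≤ B := by linarith
    have h2 : B ^ p ≤ B ^ p * B := le_mul_of_one_le_right (by positivity) (by linarith)
    calc _ ≤ ‖((y + v) ^ p - y ^ p - p * v * y ^ (p - 1)) * y‖ + ‖((y + v) ^ p - y ^ p) * v‖ :=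
          e ▸ norm_add_le _ _
      _ ≤ (p ^ 2 * ‖v‖ ^ 2 * B ^ p) * B + (p * ‖v‖ * B ^ p) * ‖v‖ := by
        rw [norm_mul, norm_mul]
        gcongr
        exact norm_add_pow_sub_pow_le hB p
      _ = p ^ 2 * ‖v‖ ^ 2 * (B ^ p * B) + p * ‖v‖ ^ 2 * B ^ p := by ring
      _ ≤ p ^ 2 * ‖v‖ ^ 2 * (B ^ p * B) + p * ‖v‖ ^ 2 * (B ^ p * B) := by gcongr
      _ ≤ p ^ 2 * ‖v‖ ^ 2 * (B ^ p * B) + (p * ‖v‖ ^ 2 * (B ^ p * B)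
          + (p + 1) * ‖v‖ ^ 2 * (B ^ p * B)) := by
        gcongr
        have : 0 ≤ (p + 1) * ‖v‖ ^ 2 * (B ^ p * B) := by positivity
        linarith
      _ = _ := by push_cast; ring

/-- The monomial `y ^ p * conj y ^ q`. -/
noncomputable def mixedPow (p q : ℕ) (y : ℂ) : ℂ := y ^ p * conj y ^ q

theorem norm_mixedPow (p q : ℕ) (y : ℂ) : ‖mixedPow p q y‖ = ‖y‖ ^ (p + q) := by
  simp [mixedPow, pow_add]

theorem measurable_mixedPow (p q : ℕ) : Measurable (mixedPow p q) := by
  unfold mixedPow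
  exact ((continuous_id.pow p).mul (Complex.continuous_conj.pow q)).measurable

theorem norm_mixedPow_add_sub_le {y v : ℂ} {B : ℝ} (hB : 1 + ‖y‖ + ‖v‖ ≤ B) (p q : ℕ) :
    ‖mixedPow p q (y + v) - mixedPow p q y‖ ≤ (p + q) * ‖v‖ * B ^ (p + q) := by
  have hy := norm_nonneg y
  have hv := norm_nonneg v
  have hB0 : 0 ≤ B := by linarith
  have hB' : 1 + ‖conj y‖ + ‖conj v‖ ≤ B := by simpa using hB
  have e : mixedPow p q (y + v) - mixedPow p q y =
      ((y + v) ^ p - y ^ p) * (conj y + conj v) ^ q +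
        y ^ p * ((conj y + conj v) ^ q - conj y ^ q) := by
    simp only [mixedPow, map_add]; ring
  have h1 : ‖conj y + conj v‖ ≤ B := (norm_add_le _ _).trans (by linarith)
  have h2 : ‖y‖ ≤ B := by linarith
  calc _ ≤ ‖((y + v) ^ p - y ^ p) * (conj y + conj v) ^ q‖ +
        ‖y ^ p * ((conj y + conj v) ^ q - conj y ^ q)‖ := e ▸ norm_add_le _ _
    _ ≤ (p * ‖v‖ * B ^ p) * B ^ q + B ^ p * (q * ‖conj v‖ * B ^ q) := by
      rw [norm_mul, norm_mul, norm_pow, norm_pow]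
      gcongr
      · exact norm_add_pow_sub_pow_le hB p
      · exact norm_add_pow_sub_pow_le hB' q
    _ = _ := by rw [RCLike.norm_conj, pow_add]; ring

/-- Product rule for the expansions of `y ^ p` and `conj y ^ q`; the cross term is a product of two
first-order increments. The hypothesis forces `B ≥ 1`, so lower powers of `B` are absorbed in `B ^
(p + q)`. The truncated exponents `p - 1`, `q - 1` are harmless because their coefficients vanish at
`0`. -/
theorem norm_mixedPow_taylor_le {y v : ℂ} {B : ℝ} (hB : 1 + ‖y‖ + ‖v‖ ≤ B) (p q : ℕ) :
    ‖mixedPow p q (y + v) - mixedPow p q y - p * v * mixedPow (p - 1) q y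
      - q * conj v * mixedPow p (q - 1) y‖ ≤ (p + q) ^ 2 * ‖v‖ ^ 2 * B ^ (p + q) := by
  have hy := norm_nonneg y
  have hv := norm_nonneg v
  have hB0 : 0 ≤ B := by linarith
  have hB' : 1 + ‖conj y‖ + ‖conj v‖ ≤ B := by simpa using hB
  have e : mixedPow p q (y + v) - mixedPow p q y - p * v * mixedPow (p - 1) q y
      - q * conj v * mixedPow p (q - 1) y =
      ((y + v) ^ p - y ^ p - p * v * y ^ (p - 1)) * (conj y + conj v) ^ q +
        y ^ p * ((conj y + conj v) ^ q - conj y ^ q - q * conj v * conj y ^ (q - 1)) +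
        p * v * y ^ (p - 1) * ((conj y + conj v) ^ q - conj y ^ q) := by
    simp only [mixedPow, map_add]; ring
  have h1 : ‖conj y + conj v‖ ≤ B := (norm_add_le _ _).trans (by linarith)
  have h2 : ‖y‖ ≤ B := by linarith
  have h3 : ‖y‖ ^ (p - 1) ≤ B ^ p :=
    (pow_le_pow_left₀ hy h2 _).trans (pow_le_pow_right₀ (by linarith) (Nat.sub_le _ _))
  calc _ ≤ ‖((y + v) ^ p - y ^ p - p * v * y ^ (p - 1)) * (conj y + conj v) ^ q‖ +
        ‖y ^ p * ((conj y + conj v) ^ q - conj y ^ q - q * conj v * conj y ^ (q - 1))‖ +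
        ‖p * v * y ^ (p - 1) * ((conj y + conj v) ^ q - conj y ^ q)‖ := e ▸ norm_add₃_le
    _ ≤ (p ^ 2 * ‖v‖ ^ 2 * B ^ p) * B ^ q + B ^ p * (q ^ 2 * ‖conj v‖ ^ 2 * B ^ q) +
        p * ‖v‖ * B ^ p * (q * ‖conj v‖ * B ^ q) := by
      simp only [norm_mul, norm_pow, Complex.norm_natCast]
      gcongr
      · exact norm_add_pow_sub_pow_sub_le hB p
      · exact norm_add_pow_sub_pow_sub_le hB' q
      · exact norm_add_pow_sub_pow_le hB' q
    _ ≤ _ := by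
      rw [RCLike.norm_conj, pow_add]
      have : 0 ≤ p * q * ‖v‖ ^ 2 * (B ^ p * B ^ q) := by positivity
      nlinarith

/-- The sum is at most `3 * M`, where `M` is the largest of the three terms, and `M ^ N` is one of
the summands on the right. -/
theorem one_add_add_pow_le {a b : ℝ} (ha : 0 ≤ a) (hb : 0 ≤ b) (N : ℕ) :
    (1 + a + b) ^ N ≤ 3 ^ N * (1 + a ^ N + b ^ N) := by
  have key : ∀ M, 1 ≤ M → a ≤ M → b ≤ M → M ^ N ≤ 1 + a ^ N + b ^ N →
      (1 + a + b) ^ N ≤ 3 ^ N * (1 + a ^ N + b ^ N) := fun M h1 h2 h3 h4 =>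
    calc (1 + a + b) ^ N ≤ (3 * M) ^ N := by gcongr; linarith
      _ = 3 ^ N * M ^ N := mul_pow _ _ _
      _ ≤ _ := by gcongr
  have hA : 0 ≤ a ^ N := by positivity
  have hB : 0 ≤ b ^ N := by positivity
  rcases le_total a b with h | h
  · rcases le_total 1 b with h' | h'
    · exact key b h' h le_rfl (by linarith)
    · exact key 1 le_rfl (h.trans h') h' (by rw [one_pow]; linarith)
  · rcases le_total 1 a with h' | h'
    · exact key a h' le_rfl h (by linarith)
    · exact key 1 le_rfl h' (h.trans h') (by rw [one_pow]; linarith)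

/-! ### Functions with finite moments of all orders -/

section AllMoments

variable {Ω : Type*} [MeasurableSpace Ω] {P : Measure Ω}

/-- `f` has finite moments of all orders. -/
def HasAllMoments {E : Type*} [NormedAddCommGroup E] (f : Ω → E) (P : Measure Ω) : Prop :=
  ∀ p : ℝ≥0∞, p ≠ ∞ → MemLp f p P

namespace HasAllMoments

theorem integrable {E : Type*} [NormedAddCommGroup E] {f : Ω → E} (hf : HasAllMoments f P) :
    Integrable f P :=
  memLp_one_iff_integrable.1 (hf 1 (by simp))

theorem norm {E : Type*} [NormedAddCommGroup E] {f : Ω → E} (hf : HasAllMoments f P) :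
    HasAllMoments (fun ω => ‖f ω‖) P := fun p hp => (hf p hp).norm

theorem add {E : Type*} [NormedAddCommGroup E] {f g : Ω → E} (hf : HasAllMoments f P)
    (hg : HasAllMoments g P) : HasAllMoments (fun ω => f ω + g ω) P :=
  fun p hp => (hf p hp).add (hg p hp)

theorem sub {E : Type*} [NormedAddCommGroup E] {f g : Ω → E} (hf : HasAllMoments f P)
    (hg : HasAllMoments g P) : HasAllMoments (fun ω => f ω - g ω) P :=
  fun p hp => (hf p hp).sub (hg p hp)

theorem mul {E : Type*} [NormedRing E] {f g : Ω → E} (hf : HasAllMoments f P)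
    (hg : HasAllMoments g P) : HasAllMoments (fun ω => f ω * g ω) P := by
  intro p hp
  have h2 : p * 2 ≠ ∞ := ENNReal.mul_ne_top hp (by norm_num)
  have : ENNReal.HolderTriple (p * 2) (p * 2) p := by
    constructor
    rcases eq_or_ne p 0 with rfl | h0
    · simp
    · rw [ENNReal.mul_inv (Or.inl h0) (Or.inl hp), ← mul_add, ENNReal.inv_two_add_inv_two,
        mul_one]
  exact (hg _ h2).mul (hf _ h2)

theorem ofReal {f : Ω → ℝ} (hf : HasAllMoments f P) : HasAllMoments (fun ω => (f ω : ℂ)) P :=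
  fun p hp => (hf p hp).ofReal

theorem conjugate {f : Ω → ℂ} (hf : HasAllMoments f P) : HasAllMoments (fun ω => conj (f ω)) P :=
  fun p hp => (hf p hp).star

theorem sum {E ι : Type*} [NormedAddCommGroup E] {f : ι → Ω → E} (hf : ∀ i, HasAllMoments (f i) P)
    (S : Finset ι) : HasAllMoments (fun ω => ∑ i ∈ S, f i ω) P :=
  fun p hp => memLp_finsetSum S fun i _ => hf i p hp

variable [IsFiniteMeasure P]

theorem const {E : Type*} [NormedAddCommGroup E] (c : E) : HasAllMoments (fun _ : Ω => c) P :=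
  fun _ _ => memLp_const c

theorem pow {E : Type*} [NormedRing E] {f : Ω → E} (hf : HasAllMoments f P) (N : ℕ) :
    HasAllMoments (fun ω => f ω ^ N) P := by
  induction N with
  | zero => simpa using const (1 : E)
  | succ N ih => simpa only [pow_succ] using ih.mul hf

theorem const_mul {E : Type*} [NormedRing E] {f : Ω → E} (hf : HasAllMoments f P) (c : E) :
    HasAllMoments (fun ω => c * f ω) P := (const c).mul hf

theorem mixedPow {f : Ω → ℂ} (hf : HasAllMoments f P) (p q : ℕ) :
    HasAllMoments (fun ω => mixedPow p q (f ω)) P := (hf.pow p).mul (hf.conjugate.pow q)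

end HasAllMoments

end AllMoments

/-! ### Mixed moments of weighted sums of independent variables -/

section WeightedSums

variable {Ω ι : Type*}

/-- The sum of the `x i`, `i ∈ S`, with weights `c i`. -/
noncomputable def weightedSum (c : ι → ℂ) (x : ι → Ω → ℝ) (S : Finset ι) (ω : Ω) : ℂ :=
  ∑ i ∈ S, c i * x i ω

variable {x : ι → Ω → ℝ} {c : ι → ℂ}

theorem weightedSum_insert [DecidableEq ι] {S : Finset ι} {i : ι} (hi : i ∉ S) (ω : Ω) :
    weightedSum c x (insert i S) ω = weightedSum c x S ω + c i * x i ω := by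
  rw [weightedSum, Finset.sum_insert hi, add_comm]; rfl

variable [MeasurableSpace Ω] {P : Measure Ω} {C : ℕ → ℝ} {δ : ℝ}

/-- Independent real random variables with zero mean, unit variance and `p`-th absolute moments
bounded by `C p`. -/
structure BoundedInputs (P : Measure Ω) (C : ℕ → ℝ) (x : ι → Ω → ℝ) : Prop where
  measurable : ∀ i, Measurable (x i)
  indep : iIndepFun x P
  mean_zero : ∀ i, ∫ ω, x i ω ∂P = 0
  second_moment : ∀ i, ∫ ω, x i ω ^ 2 ∂P = 1
  hasAllMoments : ∀ i, HasAllMoments (x i) P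
  moment_le : ∀ i p, ∫ ω, |x i ω| ^ p ∂P ≤ C p

theorem HasAllMoments.norm_integral_le {E : Type*} [NormedAddCommGroup E] [NormedSpace ℝ E]
    {f : Ω → E} {g : Ω → ℝ} (hg : HasAllMoments g P) (h : ∀ ω, ‖f ω‖ ≤ g ω) :
    ‖∫ ω, f ω ∂P‖ ≤ ∫ ω, g ω ∂P :=
  norm_integral_le_of_norm_le hg.integrable (Eventually.of_forall h)

namespace BoundedInputs

variable (hx : BoundedInputs P C x)
include hx

theorem bound_nonneg (i : ι) (p : ℕ) : 0 ≤ C p :=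
  (integral_nonneg fun _ => by positivity).trans (hx.moment_le i p)

theorem measurable_weightedSum (S : Finset ι) : Measurable (weightedSum c x S) :=
  Finset.measurable_sum S fun i _ =>
    (Complex.measurable_ofReal.comp (hx.measurable i)).const_mul (c i)

theorem indepFun_weightedSum {S : Finset ι} {i : ι} (hi : i ∉ S) :
    IndepFun (x i) (weightedSum c x S) P := by
  classical
  have h := hx.indep.indepFun_finset S {i} (by simpa using hi) hx.measurable
  have hm : Measurable fun y : ({i} : Finset ι) → ℝ => y ⟨i, by simp⟩ := measurable_pi_apply _
  have h2 := h.comp (φ := fun y : S → ℝ => ∑ s : S, c s * (y s : ℂ))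
    (ψ := fun y : ({i} : Finset ι) → ℝ => y ⟨i, by simp⟩) (by fun_prop) hm
  refine IndepFun.symm ?_
  convert h2 using 1
  · ext ω
    exact (Finset.sum_coe_sort S fun s => c s * (x s ω : ℂ)).symm
  · rfl

theorem integral_mul_weightedSum {S : Finset ι} {i : ι} (hi : i ∉ S) {f : ℝ → ℂ} {g : ℂ → ℂ}
    (hf : Measurable f) (hg : Measurable g) :
    ∫ ω, f (x i ω) * g (weightedSum c x S ω) ∂P =
      (∫ ω, f (x i ω) ∂P) * ∫ ω, g (weightedSum c x S ω) ∂P :=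
  (hx.indepFun_weightedSum hi).integral_fun_comp_mul_comp (hx.measurable i).aemeasurable
    (hx.measurable_weightedSum S).aemeasurable hf.aestronglyMeasurable hg.aestronglyMeasurable

theorem integral_mul_weightedSum_real {S : Finset ι} {i : ι} (hi : i ∉ S) {f : ℝ → ℝ} {g : ℂ → ℝ}
    (hf : Measurable f) (hg : Measurable g) :
    ∫ ω, f (x i ω) * g (weightedSum c x S ω) ∂P =
      (∫ ω, f (x i ω) ∂P) * ∫ ω, g (weightedSum c x S ω) ∂P :=
  (hx.indepFun_weightedSum hi).integral_fun_comp_mul_comp (hx.measurable i).aemeasurable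
    (hx.measurable_weightedSum S).aemeasurable hf.aestronglyMeasurable hg.aestronglyMeasurable

variable [IsProbabilityMeasure P]

theorem hasAllMoments_weightedSum (S : Finset ι) : HasAllMoments (weightedSum c x S) P :=
  HasAllMoments.sum (fun i => (hx.hasAllMoments i).ofReal.const_mul (c i)) S

/-- Taylor expansion of `‖y‖ ^ (2 * r) = mixedPow r r y` around the old sum. The first-order terms
have mean zero, since the new input is centred and independent of the old sum; the remainder costs a
factor `δ ^ 2`. The bound is arranged so that `1 + 𝔼 ‖Y‖ ^ (2 * r)` grows by a factor `1 + K * δ ^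
2`. -/
theorem integral_norm_pow_insert_le [DecidableEq ι] (hδ : δ ≤ 1) (hc : ∀ i, ‖c i‖ ≤ δ)
    {S : Finset ι} {i : ι} (hi : i ∉ S) (r : ℕ) :
    ∫ ω, ‖weightedSum c x (insert i S) ω‖ ^ (2 * r) ∂P ≤
      ∫ ω, ‖weightedSum c x S ω‖ ^ (2 * r) ∂P + (2 * r) ^ 2 * 3 ^ (2 * r) * (1 + C (2 * r + 2)) *
        δ ^ 2 * (1 + ∫ ω, ‖weightedSum c x S ω‖ ^ (2 * r) ∂P) := by
  set Y := weightedSum c x S with hY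
  have hYm : HasAllMoments Y P := hx.hasAllMoments_weightedSum S
  have hxm := hx.hasAllMoments i
  have hδ0 : 0 ≤ δ := (norm_nonneg _).trans (hc i)
  have hv : HasAllMoments (fun ω => c i * (x i ω : ℂ)) P := hxm.ofReal.const_mul _
  have hG : ∀ y : ℂ, ((‖y‖ ^ (2 * r) : ℝ) : ℂ) = mixedPow r r y := fun y => by
    rw [mixedPow, ← mul_pow, Complex.mul_conj, Complex.normSq_eq_norm_sq, pow_mul]; push_cast; rfl
  have e1 : ∫ ω, (mixedPow r r (Y ω + c i * x i ω) - mixedPow r r (Y ω)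
        - r * (c i * x i ω) * mixedPow (r - 1) r (Y ω)
        - r * conj (c i * x i ω) * mixedPow r (r - 1) (Y ω)) ∂P =
      ((∫ ω, ‖weightedSum c x (insert i S) ω‖ ^ (2 * r) ∂P -
        ∫ ω, ‖Y ω‖ ^ (2 * r) ∂P : ℝ) : ℂ) := by
    have h0 : ∫ ω, (x i ω : ℂ) ∂P = 0 := by
      rw [integral_complex_ofReal, hx.mean_zero i]; simp
    have z1 : ∫ ω, r * (c i * x i ω) * mixedPow (r - 1) r (Y ω) ∂P = 0 := by
      have := hx.integral_mul_weightedSum (c := c) hi (f := fun t => r * (c i * t))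
        (by fun_prop) (measurable_mixedPow (r - 1) r)
      rw [this, integral_const_mul, integral_const_mul, h0]; simp
    have z2 : ∫ ω, r * conj (c i * x i ω) * mixedPow r (r - 1) (Y ω) ∂P = 0 := by
      have := hx.integral_mul_weightedSum (c := c) hi (f := fun t => r * (conj (c i) * t))
        (by fun_prop) (measurable_mixedPow r (r - 1))
      simp only [map_mul, Complex.conj_ofReal]
      rw [this, integral_const_mul, integral_const_mul, h0]; simp
    rw [integral_sub, integral_sub, integral_sub, z1, z2]
    · push_cast
      rw [← integral_complex_ofReal, ← integral_complex_ofReal]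
      simp only [hG, sub_zero, weightedSum_insert hi, ← hY]
    · exact ((hYm.add hv).mixedPow r r).integrable
    · exact (hYm.mixedPow r r).integrable
    · exact (((hYm.add hv).mixedPow r r).sub (hYm.mixedPow r r)).integrable
    · exact ((hv.const_mul _).mul (hYm.mixedPow _ _)).integrable
    · exact ((((hYm.add hv).mixedPow r r).sub (hYm.mixedPow r r)).sub
        ((hv.const_mul _).mul (hYm.mixedPow _ _))).integrable
    · exact ((hv.conjugate.const_mul _).mul (hYm.mixedPow _ _)).integrable
  have hbm : HasAllMoments (fun ω => (2 * r) ^ 2 * 3 ^ (2 * r) * δ ^ 2 *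
      (|x i ω| ^ 2 * (1 + ‖Y ω‖ ^ (2 * r)) + |x i ω| ^ (2 * r + 2))) P :=
    (((hxm.norm.pow 2).mul ((HasAllMoments.const 1).add (hYm.norm.pow _))).add
      (hxm.norm.pow _)).const_mul _
  have e2 : ‖∫ ω, (mixedPow r r (Y ω + c i * x i ω) - mixedPow r r (Y ω)
        - r * (c i * x i ω) * mixedPow (r - 1) r (Y ω)
        - r * conj (c i * x i ω) * mixedPow r (r - 1) (Y ω)) ∂P‖ ≤
      ∫ ω, (2 * r) ^ 2 * 3 ^ (2 * r) * δ ^ 2 *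
        (|x i ω| ^ 2 * (1 + ‖Y ω‖ ^ (2 * r)) + |x i ω| ^ (2 * r + 2)) ∂P := by
    refine HasAllMoments.norm_integral_le hbm fun ω => ?_
    have hv1 : ‖c i * (x i ω : ℂ)‖ ≤ δ * |x i ω| := by
      rw [norm_mul, Complex.norm_real, Real.norm_eq_abs]; gcongr; exact hc i
    have hv2 : ‖c i * (x i ω : ℂ)‖ ≤ |x i ω| :=
      hv1.trans (mul_le_of_le_one_left (abs_nonneg _) hδ)
    refine (norm_mixedPow_taylor_le (B := 1 + ‖Y ω‖ + |x i ω|) (by gcongr) r r).trans ?_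
    calc ((r : ℝ) + r) ^ 2 * ‖c i * (x i ω : ℂ)‖ ^ 2 * (1 + ‖Y ω‖ + |x i ω|) ^ (r + r)
        ≤ ((r : ℝ) + r) ^ 2 * (δ * |x i ω|) ^ 2 *
          (3 ^ (r + r) * (1 + ‖Y ω‖ ^ (r + r) + |x i ω| ^ (r + r))) := by
          gcongr
          exact one_add_add_pow_le (norm_nonneg _) (abs_nonneg _) _
      _ = _ := by rw [← two_mul, ← two_mul]; ring
  have e3 : ∫ ω, (2 * r) ^ 2 * 3 ^ (2 * r) * δ ^ 2 *
        (|x i ω| ^ 2 * (1 + ‖Y ω‖ ^ (2 * r)) + |x i ω| ^ (2 * r + 2)) ∂P ≤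
      (2 * r) ^ 2 * 3 ^ (2 * r) * δ ^ 2 *
        ((1 + ∫ ω, ‖Y ω‖ ^ (2 * r) ∂P) + C (2 * r + 2)) := by
    simp only [← Real.norm_eq_abs]
    rw [integral_const_mul, integral_add
      ((hxm.norm.pow 2).mul ((HasAllMoments.const 1).add (hYm.norm.pow _))).integrable
      (hxm.norm.pow _).integrable,
      hx.integral_mul_weightedSum_real (c := c) hi (f := fun t => ‖t‖ ^ 2)
        (g := fun y => 1 + ‖y‖ ^ (2 * r)) (by fun_prop) (by fun_prop)]
    simp only [Real.norm_eq_abs, sq_abs, hx.second_moment i, one_mul]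
    rw [integral_add (integrable_const _) (hYm.norm.pow _).integrable]
    simp only [integral_const, probReal_univ, smul_eq_mul, mul_one]
    gcongr
    exact hx.moment_le i _
  have hI : 0 ≤ ∫ ω, ‖Y ω‖ ^ (2 * r) ∂P := integral_nonneg fun _ => by positivity
  have hC := hx.bound_nonneg i (2 * r + 2)
  rw [e1, Complex.norm_real] at e2
  have e4 := (le_abs_self _).trans (e2.trans e3)
  have e5 : (2 * r : ℝ) ^ 2 * 3 ^ (2 * r) * δ ^ 2 *
        ((1 + ∫ ω, ‖Y ω‖ ^ (2 * r) ∂P) + C (2 * r + 2)) ≤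
      (2 * r) ^ 2 * 3 ^ (2 * r) * (1 + C (2 * r + 2)) * δ ^ 2 *
        (1 + ∫ ω, ‖Y ω‖ ^ (2 * r) ∂P) := by
    have : (1 + ∫ ω, ‖Y ω‖ ^ (2 * r) ∂P) + C (2 * r + 2) ≤
      (1 + C (2 * r + 2)) * (1 + ∫ ω, ‖Y ω‖ ^ (2 * r) ∂P) := by nlinarith
    calc _ ≤ (2 * r : ℝ) ^ 2 * 3 ^ (2 * r) * δ ^ 2 *
          ((1 + C (2 * r + 2)) * (1 + ∫ ω, ‖Y ω‖ ^ (2 * r) ∂P)) := by gcongr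
      _ = _ := by ring
  linarith


/-- Iterating the one-input estimate gives `(1 + K * δ ^ 2) ^ S.card ≤ exp (K * S.card * δ ^ 2) ≤
exp K`. -/
theorem integral_norm_pow_even_le (hδ : δ ≤ 1) (hc : ∀ i, ‖c i‖ ≤ δ)
    {S : Finset ι} (hS : S.card * δ ^ 2 ≤ 1) (r : ℕ) :
    ∫ ω, ‖weightedSum c x S ω‖ ^ (2 * r) ∂P ≤
      2 * Real.exp ((2 * r) ^ 2 * 3 ^ (2 * r) * (1 + |C (2 * r + 2)|)) := by
  classical
  -- The absolute value keeps `K` nonnegative even without any input, when the sign of `C` is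
  -- unknown.
  set K : ℝ := (2 * r) ^ 2 * 3 ^ (2 * r) * (1 + |C (2 * r + 2)|) with hK
  have hK0 : 0 ≤ K := by positivity
  have main : ∀ S : Finset ι, 1 + ∫ ω, ‖weightedSum c x S ω‖ ^ (2 * r) ∂P ≤
      2 * (1 + K * δ ^ 2) ^ S.card := by
    intro S
    induction S using Finset.induction_on with
    | empty =>
      -- The empty sum has moment `0 ^ (2 * r)`, which is `1` for `r = 0`; hence the factor `2`.
      have : (0 : ℝ) ^ (2 * r) ≤ 1 := pow_le_one₀ le_rfl zero_le_one
      simp [weightedSum]; linarith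
    | insert i S hi ih =>
      rw [Finset.card_insert_of_notMem hi]
      have h := hx.integral_norm_pow_insert_le hδ hc hi r
      rw [← abs_of_nonneg (hx.bound_nonneg i (2 * r + 2)), ← hK] at h
      calc _ ≤ (1 + ∫ ω, ‖weightedSum c x S ω‖ ^ (2 * r) ∂P) * (1 + K * δ ^ 2) := by linarith
        _ ≤ 2 * (1 + K * δ ^ 2) ^ S.card * (1 + K * δ ^ 2) := by gcongr
        _ = _ := by ring
  calc _ ≤ 1 + ∫ ω, ‖weightedSum c x S ω‖ ^ (2 * r) ∂P := by linarith
    _ ≤ 2 * (1 + K * δ ^ 2) ^ S.card := main S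
    _ ≤ 2 * Real.exp (K * δ ^ 2) ^ S.card := by
      gcongr
      linarith [Real.add_one_le_exp (K * δ ^ 2)]
    _ ≤ 2 * Real.exp K := by
      rw [← Real.exp_nat_mul]
      gcongr
      nlinarith

end BoundedInputs

/-- A bound for the `N`-th absolute moment of a normalized weighted sum. -/
noncomputable def sumMomentBound (C : ℕ → ℝ) (N : ℕ) : ℝ :=
  1 + 2 * Real.exp ((2 * N) ^ 2 * 3 ^ (2 * N) * (1 + |C (2 * N + 2)|))

/-- A bound for the `N`-th moment of `1 + |Y| + |x|`, with `Y` a normalized weighted sum and `x` one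
of the inputs. -/
noncomputable def jointMomentBound (C : ℕ → ℝ) (N : ℕ) : ℝ :=
  3 ^ N * (1 + sumMomentBound C N + |C N|)

theorem sumMomentBound_nonneg (C : ℕ → ℝ) (N : ℕ) : 0 ≤ sumMomentBound C N := by
  unfold sumMomentBound; positivity

theorem jointMomentBound_nonneg (C : ℕ → ℝ) (N : ℕ) : 0 ≤ jointMomentBound C N := by
  have := sumMomentBound_nonneg C N
  unfold jointMomentBound; positivity

namespace BoundedInputs

variable [IsProbabilityMeasure P] (hx : BoundedInputs P C x)
include hx

theorem integral_norm_pow_le (hδ : δ ≤ 1) (hc : ∀ i, ‖c i‖ ≤ δ)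
    {S : Finset ι} (hS : S.card * δ ^ 2 ≤ 1) (N : ℕ) :
    ∫ ω, ‖weightedSum c x S ω‖ ^ N ∂P ≤ sumMomentBound C N := by
  have hY := (hx.hasAllMoments_weightedSum (c := c) S).norm
  calc ∫ ω, ‖weightedSum c x S ω‖ ^ N ∂P ≤ ∫ ω, (1 + ‖weightedSum c x S ω‖ ^ (2 * N)) ∂P := by
        refine integral_mono (hY.pow N).integrable
          ((HasAllMoments.const 1).add (hY.pow _)).integrable fun ω => ?_
        simp only [mul_comm 2 N, pow_mul]
        nlinarith [sq_nonneg (‖weightedSum c x S ω‖ ^ N - 1),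
          sq_nonneg (‖weightedSum c x S ω‖ ^ N)]
    _ = 1 + ∫ ω, ‖weightedSum c x S ω‖ ^ (2 * N) ∂P := by
      rw [integral_add (integrable_const _) (hY.pow _).integrable]; simp
    _ ≤ _ := by
      unfold sumMomentBound
      gcongr
      exact hx.integral_norm_pow_even_le hδ hc hS N

theorem hasAllMoments_one_add (S : Finset ι) (i : ι) :
    HasAllMoments (fun ω => 1 + ‖weightedSum c x S ω‖ + |x i ω|) P :=
  ((HasAllMoments.const 1).add (hx.hasAllMoments_weightedSum S).norm).add (hx.hasAllMoments i).norm

theorem integral_one_add_pow_le (hδ : δ ≤ 1) (hc : ∀ i, ‖c i‖ ≤ δ)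
    {S : Finset ι} (hS : S.card * δ ^ 2 ≤ 1) (i : ι) (N : ℕ) :
    ∫ ω, (1 + ‖weightedSum c x S ω‖ + |x i ω|) ^ N ∂P ≤ jointMomentBound C N := by
  have hY := (hx.hasAllMoments_weightedSum (c := c) S).norm.pow N
  have hX : HasAllMoments (fun ω => |x i ω| ^ N) P := (hx.hasAllMoments i).norm.pow N
  have h1 := (HasAllMoments.const (1 : ℝ)).add hY
  calc _ ≤ ∫ ω, 3 ^ N * (1 + ‖weightedSum c x S ω‖ ^ N + |x i ω| ^ N) ∂P :=
        integral_mono ((hx.hasAllMoments_one_add S i).pow N).integrable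
          ((h1.add hX).const_mul _).integrable
          fun ω => one_add_add_pow_le (norm_nonneg _) (abs_nonneg _) N
    _ = 3 ^ N * (1 + ∫ ω, ‖weightedSum c x S ω‖ ^ N ∂P + ∫ ω, |x i ω| ^ N ∂P) := by
      rw [integral_const_mul, integral_add h1.integrable hX.integrable,
        integral_add (integrable_const _) hY.integrable]
      simp
    _ ≤ _ := by
      unfold jointMomentBound
      gcongr
      · exact hx.integral_norm_pow_le hδ hc hS N
      · exact (hx.moment_le i N).trans (le_abs_self _)

/-- Approximate integration by parts: for `f = mixedPow p q`, `X = Y + c x` and `x` independent of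
`Y`, the mean of `x * f X` is that of `c * ∂f X + conj c * ∂̄f X` up to `O(δ ^ 2)`, because `𝔼 x =
0` and `𝔼 x ^ 2 = 1`. -/
theorem norm_integral_input_mul_sub_le [DecidableEq ι] (hδ : δ ≤ 1) (hc : ∀ i, ‖c i‖ ≤ δ)
    {S : Finset ι} (hS : S.card * δ ^ 2 ≤ 1) {i : ι} (hi : i ∉ S) (p q : ℕ) :
    ‖∫ ω, x i ω * mixedPow p q (weightedSum c x (insert i S) ω) ∂P
      - p * c i * ∫ ω, mixedPow (p - 1) q (weightedSum c x (insert i S) ω) ∂P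
      - q * conj (c i) * ∫ ω, mixedPow p (q - 1) (weightedSum c x (insert i S) ω) ∂P‖ ≤
      2 * (p + q) ^ 2 * jointMomentBound C (p + q + 3) * δ ^ 2 := by
  have hδ0 : 0 ≤ δ := (norm_nonneg _).trans (hc i)
  set Y := weightedSum c x S with hY
  have hYm : HasAllMoments Y P := hx.hasAllMoments_weightedSum S
  have hxm : HasAllMoments (fun ω => (x i ω : ℂ)) P := (hx.hasAllMoments i).ofReal
  simp only [weightedSum_insert hi, ← hY]
  have hXm : HasAllMoments (fun ω => Y ω + c i * x i ω) P := hYm.add (hxm.const_mul _)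
  have hx2 : HasAllMoments (fun ω => (x i ω : ℂ) ^ 2 - 1) P :=
    (hxm.pow 2).sub (HasAllMoments.const 1)
  have h0 : ∫ ω, (x i ω : ℂ) ∂P = 0 := by
    rw [integral_complex_ofReal, hx.mean_zero i]; simp
  have h2 : ∫ ω, ((x i ω : ℂ) ^ 2 - 1) ∂P = 0 := by
    rw [integral_sub (hxm.pow 2).integrable (integrable_const _)]
    simp only [← Complex.ofReal_pow]
    rw [integral_complex_ofReal, hx.second_moment i]
    simp
  have z1 : ∫ ω, x i ω * mixedPow p q (Y ω) ∂P = 0 := by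
    rw [hx.integral_mul_weightedSum (c := c) hi (f := fun t => (t : ℂ)) (by fun_prop)
      (measurable_mixedPow p q), h0, zero_mul]
  have z2 : ∀ p q, ∫ ω, ((x i ω : ℂ) ^ 2 - 1) * mixedPow p q (Y ω) ∂P = 0 := fun p q => by
    rw [hx.integral_mul_weightedSum (c := c) hi (f := fun t => (t : ℂ) ^ 2 - 1) (by fun_prop)
      (measurable_mixedPow p q), h2, zero_mul]
  -- Three terms of mean zero are subtracted, with factors `x` or `x ^ 2 - 1` independent of `Y`;
  -- the integrand then becomes `O(δ ^ 2)` pointwise.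
  have e : ∫ ω, x i ω * mixedPow p q (Y ω + c i * x i ω) ∂P
      - p * c i * ∫ ω, mixedPow (p - 1) q (Y ω + c i * x i ω) ∂P
      - q * conj (c i) * ∫ ω, mixedPow p (q - 1) (Y ω + c i * x i ω) ∂P =
      ∫ ω, (x i ω * mixedPow p q (Y ω + c i * x i ω)
      - p * c i * mixedPow (p - 1) q (Y ω + c i * x i ω)
      - q * conj (c i) * mixedPow p (q - 1) (Y ω + c i * x i ω)
      - x i ω * mixedPow p q (Y ω)
      - p * c i * (((x i ω : ℂ) ^ 2 - 1) * mixedPow (p - 1) q (Y ω))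
      - q * conj (c i) * (((x i ω : ℂ) ^ 2 - 1) * mixedPow p (q - 1) (Y ω))) ∂P := by
    have i1 := hxm.mul (hXm.mixedPow p q)
    have i2 := i1.sub ((hXm.mixedPow (p - 1) q).const_mul (p * c i))
    have i3 := i2.sub ((hXm.mixedPow p (q - 1)).const_mul (q * conj (c i)))
    have i4 := i3.sub (hxm.mul (hYm.mixedPow p q))
    have i5 := i4.sub ((hx2.mul (hYm.mixedPow (p - 1) q)).const_mul (p * c i))
    rw [integral_sub i5.integrable
        ((hx2.mul (hYm.mixedPow p (q - 1))).const_mul (q * conj (c i))).integrable,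
      integral_sub i4.integrable
        ((hx2.mul (hYm.mixedPow (p - 1) q)).const_mul (p * c i)).integrable,
      integral_sub i3.integrable (hxm.mul (hYm.mixedPow p q)).integrable,
      integral_sub i2.integrable ((hXm.mixedPow p (q - 1)).const_mul (q * conj (c i))).integrable,
      integral_sub i1.integrable ((hXm.mixedPow (p - 1) q).const_mul (p * c i)).integrable,
      integral_const_mul, integral_const_mul, integral_const_mul, integral_const_mul,
      z1, z2, z2]
    simp
  rw [e]
  calc _ ≤ ∫ ω, 2 * ((p : ℝ) + q) ^ 2 * δ ^ 2 * (1 + ‖Y ω‖ + |x i ω|) ^ (p + q + 3) ∂P := by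
        refine HasAllMoments.norm_integral_le
          (((hx.hasAllMoments_one_add S i).pow _).const_mul _) fun ω => ?_
        set y := Y ω
        set t := x i ω
        set v : ℂ := c i * t with hv
        set B := 1 + ‖y‖ + |t| with hB
        have hB1 : 1 ≤ B := by have := norm_nonneg y; have := abs_nonneg t; linarith
        have htB : |t| ≤ B := by have := norm_nonneg y; linarith
        have hv1 : ‖v‖ ≤ δ * |t| := by
          rw [hv, norm_mul, Complex.norm_real, Real.norm_eq_abs]; gcongr; exact hc i
        have hvB : 1 + ‖y‖ + ‖v‖ ≤ B := by
          rw [hB]; gcongr; exact hv1.trans (mul_le_of_le_one_left (abs_nonneg _) hδ)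
        have a1 := norm_mixedPow_taylor_le hvB p q
        have a2 : ‖mixedPow (p - 1) q (y + v) - mixedPow (p - 1) q y‖ ≤
            (p + q) * δ * B ^ (p + q + 3) := by
          refine (norm_mixedPow_add_sub_le hvB _ _).trans ?_
          have h1 : ((p - 1 : ℕ) : ℝ) ≤ p := by exact_mod_cast Nat.sub_le _ _
          calc _ ≤ ((p : ℝ) + q) * (δ * B) * B ^ (p - 1 + q) := by
                gcongr
                exact hv1.trans (by gcongr)
            _ = (p + q) * δ * B ^ (p - 1 + q + 1) := by ring
            _ ≤ _ := by gcongr; exacts [Nat.sub_le _ _, by norm_num]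
        have a3 : ‖mixedPow p (q - 1) (y + v) - mixedPow p (q - 1) y‖ ≤
            (p + q) * δ * B ^ (p + q + 3) := by
          refine (norm_mixedPow_add_sub_le hvB _ _).trans ?_
          have h1 : ((q - 1 : ℕ) : ℝ) ≤ q := by exact_mod_cast Nat.sub_le _ _
          calc _ ≤ ((p : ℝ) + q) * (δ * B) * B ^ (p + (q - 1)) := by
                gcongr
                exact hv1.trans (by gcongr)
            _ = (p + q) * δ * B ^ (p + (q - 1) + 1) := by ring
            _ ≤ _ := by gcongr; exacts [Nat.sub_le _ _, by norm_num]
        -- What remains is `t` times the second-order Taylor remainder, minus `c` and `conj c` times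
        -- increments of the derivatives. The first is of order `B * (δ * B) ^ 2 * B ^ (p + q)`,
        -- whence the exponent `p + q + 3`.
        have e' : (t * mixedPow p q (y + v) - p * c i * mixedPow (p - 1) q (y + v)
            - q * conj (c i) * mixedPow p (q - 1) (y + v) - t * mixedPow p q y
            - p * c i * (((t : ℂ) ^ 2 - 1) * mixedPow (p - 1) q y)
            - q * conj (c i) * (((t : ℂ) ^ 2 - 1) * mixedPow p (q - 1) y)) =
            t * (mixedPow p q (y + v) - mixedPow p q y - p * v * mixedPow (p - 1) q y
              - q * conj v * mixedPow p (q - 1) y)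
            - p * c i * (mixedPow (p - 1) q (y + v) - mixedPow (p - 1) q y)
            - q * conj (c i) * (mixedPow p (q - 1) (y + v) - mixedPow p (q - 1) y) := by
          rw [hv]; simp only [map_mul, Complex.conj_ofReal]; ring
        rw [e']
        refine (norm_sub_le _ _).trans ((add_le_add (norm_sub_le _ _) le_rfl).trans ?_)
        simp only [norm_mul, Complex.norm_natCast, Complex.norm_real, Real.norm_eq_abs,
          RCLike.norm_conj]
        calc _ ≤ B * ((p + q) ^ 2 * (δ * B) ^ 2 * B ^ (p + q))
              + p * δ * ((p + q) * δ * B ^ (p + q + 3))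
              + q * δ * ((p + q) * δ * B ^ (p + q + 3)) := by
              gcongr
              · refine a1.trans ?_
                gcongr
                exact hv1.trans (by gcongr)
              · exact hc i
              · exact hc i
          _ = _ := by ring
    _ = 2 * ((p : ℝ) + q) ^ 2 * δ ^ 2 * ∫ ω, (1 + ‖Y ω‖ + |x i ω|) ^ (p + q + 3) ∂P :=
      integral_const_mul _ _
    _ ≤ 2 * ((p : ℝ) + q) ^ 2 * δ ^ 2 * jointMomentBound C (p + q + 3) := by
      gcongr
      exact hx.integral_one_add_pow_le hδ hc hS i _
    _ = _ := by ring

variable [Fintype ι]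

theorem norm_integral_mixedPow_le (hδ : δ ≤ 1) (hc : ∀ i, ‖c i‖ ≤ δ)
    (hn : Fintype.card ι * δ ^ 2 ≤ 1) (p q : ℕ) :
    ‖∫ ω, mixedPow p q (weightedSum c x Finset.univ ω) ∂P‖ ≤ sumMomentBound C (p + q) := by
  refine (norm_integral_le_integral_norm _).trans ?_
  simp only [norm_mixedPow]
  exact hx.integral_norm_pow_le hδ hc (by simpa using hn) _

/-- One factor `X` is written as `∑ c i * x i`, and each summand is integrated by parts against the
sum over the other indices. Each error is `O(δ ^ 3)` and there are at most `δ⁻²` of them when `δ >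
0`, which leaves `O(δ)`. -/
theorem norm_integral_mixedPow_succ_sub_le (hδ0 : 0 ≤ δ) (hδ : δ ≤ 1) (hc : ∀ i, ‖c i‖ ≤ δ)
    (hn : Fintype.card ι * δ ^ 2 ≤ 1) (p q : ℕ) :
    ‖∫ ω, mixedPow (p + 1) q (weightedSum c x Finset.univ ω) ∂P
      - p * (∑ i, c i ^ 2) * ∫ ω, mixedPow (p - 1) q (weightedSum c x Finset.univ ω) ∂P
      - q * (∑ i, c i * conj (c i)) *
        ∫ ω, mixedPow p (q - 1) (weightedSum c x Finset.univ ω) ∂P‖ ≤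
      2 * (p + q) ^ 2 * jointMomentBound C (p + q + 3) * δ := by
  classical
  set X := weightedSum c x Finset.univ with hX
  have hXm : HasAllMoments X P := hx.hasAllMoments_weightedSum _
  have e1 : ∫ ω, mixedPow (p + 1) q (X ω) ∂P = ∑ i, c i * ∫ ω, x i ω * mixedPow p q (X ω) ∂P := by
    simp only [← integral_const_mul]
    rw [← integral_finsetSum _ fun i _ =>
      (((hx.hasAllMoments i).ofReal.mul (hXm.mixedPow p q)).const_mul _).integrable]
    refine integral_congr_ae (Eventually.of_forall fun ω => ?_)
    simp only [← mul_assoc, ← Finset.sum_mul]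
    simp only [mixedPow, pow_succ, mul_assoc, mul_comm]
    rw [hX, weightedSum]
  set K := 2 * ((p : ℝ) + q) ^ 2 * jointMomentBound C (p + q + 3)
  have hK : 0 ≤ K := by have := jointMomentBound_nonneg C (p + q + 3); positivity
  have e2 : ∫ ω, mixedPow (p + 1) q (X ω) ∂P
      - p * (∑ i, c i ^ 2) * ∫ ω, mixedPow (p - 1) q (X ω) ∂P
      - q * (∑ i, c i * conj (c i)) * ∫ ω, mixedPow p (q - 1) (X ω) ∂P =
      ∑ i, c i * (∫ ω, x i ω * mixedPow p q (X ω) ∂P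
        - p * c i * ∫ ω, mixedPow (p - 1) q (X ω) ∂P
        - q * conj (c i) * ∫ ω, mixedPow p (q - 1) (X ω) ∂P) := by
    rw [e1]
    simp only [mul_sub, Finset.sum_sub_distrib, Finset.mul_sum, Finset.sum_mul]
    congr 1
    · congr 1
      exact Finset.sum_congr rfl fun i _ => by ring
    · exact Finset.sum_congr rfl fun i _ => by ring
  rw [e2]
  calc _ ≤ ∑ i : ι, δ * (K * δ ^ 2) := by
        refine norm_sum_le_of_le _ fun i _ => ?_
        rw [norm_mul]
        gcongr
        · exact hc i
        · have hS : ((Finset.univ.erase i).card : ℝ) * δ ^ 2 ≤ 1 := by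
            refine le_trans ?_ hn
            gcongr
            exact Finset.card_le_univ _
          have := hx.norm_integral_input_mul_sub_le hδ hc hS (Finset.notMem_erase i _) p q
          rwa [Finset.insert_erase (Finset.mem_univ i)] at this
    _ = (Fintype.card ι * δ ^ 2) * (K * δ) := by
      rw [Finset.sum_const, Finset.card_univ, nsmul_eq_mul]; ring
    _ ≤ 1 * (K * δ) := by gcongr
    _ = _ := one_mul _

end BoundedInputs

/-- The mixed moment `𝔼 Z ^ p * conj Z ^ q` of a standard complex Gaussian variable `Z`. -/
def gaussianMixedMoment (p q : ℕ) : ℕ := if p = q then p.factorial else 0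

theorem gaussianMixedMoment_comm (p q : ℕ) : gaussianMixedMoment p q = gaussianMixedMoment q p := by
  unfold gaussianMixedMoment
  split_ifs with h h' h' <;> simp_all

/-- The mixed moments of a normalized weighted sum with vanishing `∑ c i ^ 2` are close to those of
a standard complex Gaussian variable. -/
theorem exists_norm_integral_mixedPow_sub_gaussian_le (C : ℕ → ℝ) (p q : ℕ) :
    ∃ K : ℝ, 0 ≤ K ∧ ∀ {Ω ι : Type*} [MeasurableSpace Ω] [Fintype ι] {P : Measure Ω}
      [IsProbabilityMeasure P] {x : ι → Ω → ℝ} {c : ι → ℂ} {δ : ℝ}, BoundedInputs P C x →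
      0 ≤ δ → δ ≤ 1 → (∀ i, ‖c i‖ ≤ δ) → Fintype.card ι * δ ^ 2 ≤ 1 → ∑ i, c i ^ 2 = 0 →
      ∑ i, c i * conj (c i) = 1 →
      ‖∫ ω, mixedPow p q (weightedSum c x Finset.univ ω) ∂P - gaussianMixedMoment p q‖ ≤ K * δ := by
  -- The recursion lowers `p` and `q` together. The constant depends only on `C`, `p`, `q`, so it
  -- serves all dimensions and all roots at once.
  induction p generalizing q with
  | zero =>
    cases q with
    | zero => exact ⟨0, le_rfl, by intros; simp [mixedPow, gaussianMixedMoment]⟩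
    | succ q =>
      refine ⟨2 * q ^ 2 * jointMomentBound C (q + 3),
        by have := jointMomentBound_nonneg C (q + 3); positivity, ?_⟩
      intro Ω ι _ _ P _ x c δ hx hδ0 hδ hc hn h1 h2
      -- For `p = 0` the conjugate moment is used: both correction terms vanish, one by `∑ c i ^ 2 =
      -- 0` and the other by its coefficient `0`.
      have h := hx.norm_integral_mixedPow_succ_sub_le hδ0 hδ hc hn q 0
      rw [← RCLike.norm_conj]
      have e : conj (∫ ω, mixedPow 0 (q + 1) (weightedSum c x Finset.univ ω) ∂P) =
          ∫ ω, mixedPow (q + 1) 0 (weightedSum c x Finset.univ ω) ∂P := by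
        rw [← integral_conj]
        simp [mixedPow]
      rw [map_sub, e]
      simpa [gaussianMixedMoment, h1] using h
  | succ p ih =>
    obtain ⟨K, hK, ih⟩ := ih (q - 1)
    refine ⟨2 * (p + q) ^ 2 * jointMomentBound C (p + q + 3) + q * K,
      by have := jointMomentBound_nonneg C (p + q + 3); positivity, ?_⟩
    intro Ω ι _ _ P _ x c δ hx hδ0 hδ hc hn h1 h2
    have h := hx.norm_integral_mixedPow_succ_sub_le hδ0 hδ hc hn p q
    have h' := ih hx hδ0 hδ hc hn h1 h2
    -- The Gaussian moments satisfy the limiting recursion exactly, also at `q = 0`.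
    have hg : (gaussianMixedMoment (p + 1) q : ℂ) = q * gaussianMixedMoment p (q - 1) := by
      cases q with
      | zero => simp [gaussianMixedMoment]
      | succ q =>
        simp only [gaussianMixedMoment, Nat.add_sub_cancel, Nat.add_right_cancel_iff]
        split_ifs with hpq
        · subst hpq; push_cast [Nat.factorial_succ]; ring
        · simp
    rw [h1, h2] at h
    set X := weightedSum c x Finset.univ
    have e : ∫ ω, mixedPow (p + 1) q (X ω) ∂P - gaussianMixedMoment (p + 1) q =
        (∫ ω, mixedPow (p + 1) q (X ω) ∂P - p * 0 * ∫ ω, mixedPow (p - 1) q (X ω) ∂P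
          - q * 1 * ∫ ω, mixedPow p (q - 1) (X ω) ∂P) +
        q * (∫ ω, mixedPow p (q - 1) (X ω) ∂P - gaussianMixedMoment p (q - 1)) := by
      rw [hg]; ring
    rw [e]
    refine (norm_add_le _ _).trans ?_
    rw [norm_mul, Complex.norm_natCast]
    calc _ ≤ 2 * ((p : ℝ) + q) ^ 2 * jointMomentBound C (p + q + 3) * δ + q * (K * δ) := by
          gcongr
      _ = _ := by ring

end WeightedSums

/-! ### Alternating words -/

section Words

variable {ι : Type*}

/-- The product `z w₀ * z' w₁ * z w₂ * ⋯`. -/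
def altProd {M : Type*} [Monoid M] (z z' : ι → M) : List ι → M
  | [] => 1
  | i :: w => z i * altProd z' z w

/-- The numbers of occurrences of `j` at even and at odd positions of the word. -/
def altCount [DecidableEq ι] (j : ι) : List ι → ℕ × ℕ
  | [] => (0, 0)
  | i :: w => ((altCount j w).2 + (if i = j then 1 else 0), (altCount j w).1)

theorem altProd_eq_prod [DecidableEq ι] [Fintype ι] {M : Type*} [CommMonoid M] (z z' : ι → M)
    (w : List ι) :
    altProd z z' w = ∏ j, z j ^ (altCount j w).1 * z' j ^ (altCount j w).2 := by
  induction w generalizing z z' with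
  | nil => simp [altProd, altCount]
  | cons i w ih =>
    rw [altProd, ih]
    simp only [altCount, pow_add, pow_ite, pow_one, pow_zero]
    have : z i = ∏ j, if i = j then z j else 1 := by simp
    conv_lhs => rw [this, ← Finset.prod_mul_distrib]
    exact Finset.prod_congr rfl fun j _ => by
      rw [mul_comm, mul_comm (z' j ^ _), mul_assoc, mul_assoc, mul_comm (z' j ^ _)]

/-- Positions start at `0`, and removing the first letter exchanges even and odd positions. -/
theorem card_even_odd_eq_altCount [DecidableEq ι] (j : ι) {m : ℕ} (w : Fin m → ι) :
    Nat.card {r : Fin m // w r = j ∧ Even (r : ℕ)} = (altCount j (List.ofFn w)).1 ∧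
      Nat.card {r : Fin m // w r = j ∧ Odd (r : ℕ)} = (altCount j (List.ofFn w)).2 := by
  induction m with
  | zero => simp [altCount]
  | succ m ih =>
    have h := ih (fun r => w r.succ)
    simp only [Nat.card_eq_fintype_card, Fintype.card_subtype, Finset.card_filter] at h ⊢
    rw [Fin.sum_univ_succ, Fin.sum_univ_succ, List.ofFn_succ, altCount]
    simp only [Fin.val_succ, Nat.even_add_one, Nat.odd_add_one, Nat.not_even_iff_odd,
      Nat.not_odd_iff_even, h.1, h.2]
    simp [add_comm]

theorem isSymmetricWord_iff_altCount [DecidableEq ι] {m : ℕ} (w : Fin m → ι) :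
    IsSymmetricWord w ↔
      ∀ j, (altCount j (List.ofFn w)).2 = (altCount j (List.ofFn w)).1 :=
  forall_congr' fun j => by
    rw [(card_even_odd_eq_altCount j w).1, (card_even_odd_eq_altCount j w).2]

theorem altCount_replicate [DecidableEq ι] (i j : ι) (m : ℕ) :
    altCount j (List.replicate (2 * m) i) = if i = j then (m, m) else (0, 0) := by
  induction m with
  | zero => simp [altCount]
  | succ m ih =>
    rw [show 2 * (m + 1) = 2 * m + 1 + 1 by ring, List.replicate_succ, List.replicate_succ,
      altCount, altCount, ih]
    split_ifs <;> simp

end Words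

/-! ### The trace of a product of left skew-circulant matrices -/

section SkewCirculant

theorem leftSkewCirculant_isSymm {R : Type*} [Neg R] {n : ℕ} (l : Fin n → R) :
    (leftSkewCirculant l).transpose = leftSkewCirculant l := by
  ext i j
  simp only [leftSkewCirculant, Matrix.transpose_apply, Matrix.of_apply, add_comm]

variable {n : ℕ}

theorem geom_sum_of_pow_eq_one {a : ℂ} (ha : a ^ n = 1) :
    ∑ i : Fin n, a ^ (i : ℕ) = if a = 1 then (n : ℂ) else 0 := by
  split_ifs with h
  · simp [h]
  · rw [Fin.sum_univ_eq_sum_range (fun i => a ^ i), geom_sum_eq h, ha, sub_self, zero_div]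

variable [NeZero n]

/-- The sign in the matrix and the sign in `a ^ (s + n) = -a ^ s` cancel, so `a ^ i * L i j` is `l s
* a ^ s * b ^ j` with `s = i + j` modulo `n`; summing over `i` is a cyclic shift. -/
theorem vecMul_leftSkewCirculant {R : Type*} [CommRing R] (l : Fin n → R) {a b : R}
    (hab : a * b = 1) (ha : a ^ n = -1) :
    Matrix.vecMul (fun i : Fin n => a ^ (i : ℕ)) (leftSkewCirculant l) =
      (∑ s, l s * a ^ (s : ℕ)) • fun i : Fin n => b ^ (i : ℕ) := by
  ext j
  have key : ∀ i : Fin n, a ^ (i : ℕ) * leftSkewCirculant l i j =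
      l (i + j) * a ^ ((i + j : Fin n) : ℕ) * b ^ (j : ℕ) := by
    intro i
    have hb : ∀ s, a ^ s * b ^ s = 1 := fun s => by rw [← mul_pow, hab, one_pow]
    simp only [leftSkewCirculant, Matrix.of_apply]
    split_ifs with h
    · have e : (⟨i + j, h⟩ : Fin n) = i + j := by
        ext; rw [Fin.val_add, Nat.mod_eq_of_lt h]
      rw [← e, pow_add]
      linear_combination (-(a ^ (i : ℕ) * l ⟨i + j, h⟩)) * hb j
    · have hlt : (i : ℕ) + j - n < n := by omega
      have e : (⟨i + j - n, hlt⟩ : Fin n) = i + j := by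
        ext; rw [Fin.val_add, Nat.mod_eq_sub_mod (by omega), Nat.mod_eq_of_lt hlt]
      have h2 : a ^ ((i : ℕ) + j - n) * a ^ n = a ^ (i : ℕ) * a ^ (j : ℕ) := by
        rw [← pow_add, ← pow_add]; congr 1; omega
      rw [ha] at h2
      rw [← e]
      linear_combination (a ^ (i : ℕ) * l ⟨i + j - n, hlt⟩) * hb j +
        b ^ (j : ℕ) * l ⟨i + j - n, hlt⟩ * h2
  simp only [Matrix.vecMul, dotProduct, key, Pi.smul_apply, smul_eq_mul, Finset.sum_mul]
  exact Equiv.sum_comp (Equiv.addRight j) fun s => l s * a ^ (s : ℕ) * b ^ (j : ℕ)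

theorem vecMul_prod_leftSkewCirculant {R ι : Type*} [CommRing R] (l : ι → Fin n → R) {a b : R}
    (hab : a * b = 1) (ha : a ^ n = -1) (w : List ι) :
    Matrix.vecMul (fun i : Fin n => a ^ (i : ℕ)) (w.map fun j => leftSkewCirculant (l j)).prod =
      altProd (fun j => ∑ s, l j s * a ^ (s : ℕ)) (fun j => ∑ s, l j s * b ^ (s : ℕ)) w •
        fun i : Fin n => (if Even w.length then a else b) ^ (i : ℕ) := by
  induction w generalizing a b with
  | nil => simp [altProd]
  | cons j w ih =>
    have hb : b ^ n = -1 := by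
      have : a ^ n * b ^ n = 1 := by rw [← mul_pow, hab, one_pow]
      rw [ha] at this; linear_combination -this
    rw [List.map_cons, List.prod_cons, ← Matrix.vecMul_vecMul, vecMul_leftSkewCirculant _ hab ha,
      Matrix.smul_vecMul, ih (mul_comm a b ▸ hab) hb, smul_smul, altProd]
    congr 1
    ext i
    simp only [List.length_cons, Nat.even_add_one]
    split_ifs <;> rfl

/-- The matrix with rows `(a t ^ i)` has inverse with entries `n⁻¹ * b t ^ i`, by orthogonality of
the distinct roots of `-1`; the trace is invariant under this change of basis. -/
theorem trace_eq_sum_vecMul {a b : Fin n → ℂ} (hab : ∀ t, a t * b t = 1) (ha : ∀ t, a t ^ n = -1)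
    (hinj : Function.Injective a) (A : Matrix (Fin n) (Fin n) ℂ) :
    A.trace = (n : ℂ)⁻¹ * ∑ t, dotProduct
      (Matrix.vecMul (fun i : Fin n => a t ^ (i : ℕ)) A) (fun i : Fin n => b t ^ (i : ℕ)) := by
  have hn : (n : ℂ) ≠ 0 := NeZero.ne _
  have hb : ∀ t, b t ^ n = -1 := fun t => by
    have : a t ^ n * b t ^ n = 1 := by rw [← mul_pow, hab, one_pow]
    rw [ha] at this; linear_combination -this
  set U : Matrix (Fin n) (Fin n) ℂ := Matrix.of fun t i => a t ^ (i : ℕ) with hU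
  set V : Matrix (Fin n) (Fin n) ℂ := Matrix.of fun i t => (n : ℂ)⁻¹ * b t ^ (i : ℕ) with hV
  have hUV : U * V = 1 := by
    ext t t'
    simp only [hU, hV, Matrix.mul_apply, Matrix.of_apply]
    have e : ∀ i : Fin n, a t ^ (i : ℕ) * ((n : ℂ)⁻¹ * b t' ^ (i : ℕ)) =
        (n : ℂ)⁻¹ * (a t * b t') ^ (i : ℕ) := fun i => by rw [mul_pow]; ring
    simp only [e, ← Finset.mul_sum]
    rw [geom_sum_of_pow_eq_one (by rw [mul_pow, ha, hb]; ring), Matrix.one_apply]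
    have : a t * b t' = 1 ↔ t = t' := by
      refine ⟨fun h => hinj ?_, fun h => h ▸ hab t⟩
      linear_combination a t' * h - a t * hab t'
    simp only [this]
    split_ifs
    · exact inv_mul_cancel₀ hn
    · simp
  have hVU : V * U = 1 := mul_eq_one_comm.1 hUV
  calc A.trace = (U * A * V).trace := by
        rw [Matrix.trace_mul_comm, ← mul_assoc, hVU, one_mul]
    _ = _ := by
      simp only [Matrix.trace, Matrix.diag, Finset.mul_sum]
      refine Finset.sum_congr rfl fun t _ => ?_
      simp only [Matrix.mul_apply, dotProduct, Matrix.vecMul, hU, hV, Matrix.of_apply,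
        Finset.mul_sum]
      exact Finset.sum_congr rfl fun i _ => by ring

/-- Diagonalization of products of left skew-circulant matrices. -/
theorem trace_prod_leftSkewCirculant {ι : Type*} (l : ι → Fin n → ℂ) {a b : Fin n → ℂ}
    (hab : ∀ t, a t * b t = 1) (ha : ∀ t, a t ^ n = -1) (hinj : Function.Injective a)
    (w : List ι) :
    (w.map fun j => leftSkewCirculant (l j)).prod.trace =
      ∑ t, if Even w.length ∨ a t ^ 2 = 1 then
        altProd (fun j => ∑ s, l j s * a t ^ (s : ℕ)) (fun j => ∑ s, l j s * b t ^ (s : ℕ)) w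
        else 0 := by
  have hn : (n : ℂ) ≠ 0 := NeZero.ne _
  rw [trace_eq_sum_vecMul hab ha hinj, Finset.mul_sum]
  refine Finset.sum_congr rfl fun t _ => ?_
  rw [vecMul_prod_leftSkewCirculant l (hab t) (ha t)]
  simp only [dotProduct, Pi.smul_apply, smul_eq_mul, mul_assoc, ← Finset.mul_sum, ← mul_pow]
  have hb : b t ^ n = -1 := by
    have : a t ^ n * b t ^ n = 1 := by rw [← mul_pow, hab, one_pow]
    rw [ha] at this; linear_combination -this
  by_cases hw : Even w.length
  · simp only [hw, if_true, true_or, hab, one_pow, Finset.sum_const, Finset.card_univ,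
      Fintype.card_fin, nsmul_eq_mul, mul_one]
    field_simp
  -- A word of odd length ends at a multiple of `(b t ^ i)`; pairing this with `(b t ^ i)` gives `∑
  -- (b t * b t) ^ i`, which vanishes unless `b t` is real.
  · have hb2 : b t * b t = 1 ↔ a t ^ 2 = 1 := by
      have h := hab t
      constructor
      · intro h'; linear_combination (a t * b t + 1) * h - a t ^ 2 * h'
      · intro h'; linear_combination (a t * b t + 1) * h - b t ^ 2 * h'
    simp only [hw, if_false, false_or]
    rw [geom_sum_of_pow_eq_one (by rw [mul_pow, hb]; ring)]
    simp only [hb2]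
    split_ifs
    · field_simp
    · simp

/-- The `n` complex numbers with `n`-th power `-1`. -/
theorem exists_injective_pow_eq_neg_one (n : ℕ) [NeZero n] :
    ∃ a : Fin n → ℂ, Function.Injective a ∧ (∀ t, a t ^ n = -1) ∧ ∀ t, ‖a t‖ = 1 := by
  have hn : n ≠ 0 := NeZero.ne n
  have hθ := Complex.isPrimitiveRoot_exp (2 * n) (by omega)
  set θ := Complex.exp (2 * Real.pi * Complex.I / (2 * n : ℕ))
  have hθn : θ ^ n = -1 := by
    have h1 : (θ ^ n) ^ 2 = 1 := by rw [← pow_mul, mul_comm n 2, hθ.pow_eq_one]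
    rcases mul_self_eq_one_iff.1 ((sq _).symm.trans h1) with h | h
    · exact absurd h (hθ.pow_ne_one_of_pos_of_lt hn (by omega))
    · exact h
  -- The roots are the odd powers of a primitive `2 * n`-th root of unity.
  refine ⟨fun t => θ ^ (2 * (t : ℕ) + 1), fun t t' h => ?_, fun t => ?_, fun t => ?_⟩
  · have := hθ.pow_inj (by omega) (by omega) h
    ext; omega
  · rw [← pow_mul, mul_comm, pow_mul, hθn, Odd.neg_one_pow ⟨t, rfl⟩]
  · rw [norm_pow, Complex.norm_eq_one_of_pow_eq_one hθ.pow_eq_one (by omega), one_pow]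

end SkewCirculant

/-! ### A family of half-independent symmetrized Rayleigh variables -/

section Model

/-- The algebra of polynomials in commuting variables `z_j` and `conj z_j`. -/
abbrev GaussianAlgebra (ι : Type*) : Type _ := AddMonoidAlgebra ℂ (ι → ℕ × ℕ)

namespace GaussianAlgebra

variable {ι : Type*}

/-- Exchange of the exponents of `z_j` and `conj z_j`. -/
def swapExponents : (ι → ℕ × ℕ) →+ (ι → ℕ × ℕ) where
  toFun m j := (m j).swap
  map_zero' := rfl
  map_add' _ _ := rfl

/-- The involution of the algebra, as a ring homomorphism. -/
noncomputable def conjRingHom : GaussianAlgebra ι →+* GaussianAlgebra ι :=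
  (AddMonoidAlgebra.mapDomainRingHom ℂ swapExponents).comp
    (AddMonoidAlgebra.mapRingHom _ (starRingEnd ℂ))

theorem conjRingHom_single (m : ι → ℕ × ℕ) (c : ℂ) :
    conjRingHom (AddMonoidAlgebra.single m c) =
      AddMonoidAlgebra.single (swapExponents m) (conj c) := by
  simp [conjRingHom]

theorem conjRingHom_conjRingHom (x : GaussianAlgebra ι) : conjRingHom (conjRingHom x) = x := by
  have : (conjRingHom.comp conjRingHom : GaussianAlgebra ι →+* GaussianAlgebra ι) =
      RingHom.id _ := by
    refine AddMonoidAlgebra.ringHom_ext (fun r => ?_) fun m => ?_ <;>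
    simp only [RingHom.comp_apply, conjRingHom_single, RingHom.id_apply, Complex.conj_conj] <;> rfl
  exact congrArg (fun f => f x) this

noncomputable instance : StarRing (GaussianAlgebra ι) where
  star := conjRingHom
  star_involutive := conjRingHom_conjRingHom
  star_mul x y := by
    rw [map_mul, mul_comm]
  star_add := map_add conjRingHom

theorem star_single (m : ι → ℕ × ℕ) (c : ℂ) :
    star (AddMonoidAlgebra.single m c : GaussianAlgebra ι) =
      AddMonoidAlgebra.single (swapExponents m) (conj c) := conjRingHom_single m c

instance : StarModule ℂ (GaussianAlgebra ι) where
  star_smul c x := by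
    have h : ∀ (c : ℂ) (x : GaussianAlgebra ι), c • x = AddMonoidAlgebra.single 0 c * x :=
      fun c x => by
        rw [Algebra.smul_def, AddMonoidAlgebra.coe_algebraMap]; rfl
    rw [h, h, star_mul, star_single, mul_comm]
    rfl

variable [DecidableEq ι]

/-- The variable `z_j`. -/
noncomputable def var (j : ι) : GaussianAlgebra ι := AddMonoidAlgebra.single (Pi.single j (1, 0)) 1

/-- The variable `conj z_j`. -/
noncomputable def varConj (j : ι) : GaussianAlgebra ι :=
  AddMonoidAlgebra.single (Pi.single j (0, 1)) 1

theorem star_var (j : ι) : star (var j) = varConj j := by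
  rw [var, star_single, map_one, varConj]
  congr 1
  ext i <;> by_cases h : i = j <;> simp [swapExponents, h]

theorem star_varConj (j : ι) : star (varConj j) = var j := by
  rw [← star_var, star_star]

variable [Fintype ι]

theorem prod_var_pow (p q : ι → ℕ) :
    ∏ j, var j ^ p j * varConj j ^ q j =
      (AddMonoidAlgebra.single (fun j => (p j, q j)) 1 : GaussianAlgebra ι) := by
  have h : ∀ j, var j ^ p j * varConj j ^ q j =
      (AddMonoidAlgebra.of ℂ (ι → ℕ × ℕ)
        (Multiplicative.ofAdd (Pi.single j (p j, q j))) : GaussianAlgebra ι) := fun j => by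
    rw [var, varConj, AddMonoidAlgebra.single_pow, AddMonoidAlgebra.single_pow,
      AddMonoidAlgebra.single_mul_single, AddMonoidAlgebra.of_apply]
    simp only [one_pow, one_mul, toAdd_ofAdd]
    congr 1
    rw [← Pi.single_smul, ← Pi.single_smul, ← Pi.single_add]
    simp
  simp only [h, ← map_prod, ← ofAdd_sum]
  rw [AddMonoidAlgebra.of_apply, toAdd_ofAdd, Finset.univ_sum_single]

/-- The linear functional with the mixed moments of independent standard complex Gaussian
variables. -/
noncomputable def mean : GaussianAlgebra ι →ₗ[ℂ] ℂ :=
  (Finsupp.linearCombination ℂ fun m : ι → ℕ × ℕ =>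
    ∏ j, (gaussianMixedMoment (m j).1 (m j).2 : ℂ)) ∘ₗ
    (AddMonoidAlgebra.coeffLinearEquiv ℂ).toLinearMap

omit [DecidableEq ι] in
theorem mean_single (m : ι → ℕ × ℕ) :
    mean (AddMonoidAlgebra.single m 1) = ∏ j, (gaussianMixedMoment (m j).1 (m j).2 : ℂ) := by
  simp [mean]

theorem mean_prod_var_pow (p q : ι → ℕ) :
    mean (∏ j, var j ^ p j * varConj j ^ q j) = ∏ j, (gaussianMixedMoment (p j) (q j) : ℂ) := by
  rw [prod_var_pow, mean_single]

omit [DecidableEq ι] in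
theorem mean_one : mean (1 : GaussianAlgebra ι) = 1 := by
  classical
  have := mean_prod_var_pow (ι := ι) 0 0
  simpa [gaussianMixedMoment] using this

end GaussianAlgebra

open GaussianAlgebra

variable {ι : Type*}

/-- The variables `!![0, z_j; conj z_j, 0]`. -/
noncomputable def rayleighVar [DecidableEq ι] (j : ι) :
    Matrix (Fin 2) (Fin 2) (GaussianAlgebra ι) :=
  !![0, var j; varConj j, 0]

/-- The mean of the normalized trace. -/
noncomputable def rayleighState [Fintype ι] :
    NCState (Matrix (Fin 2) (Fin 2) (GaussianAlgebra ι)) where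
  toLinearMap := (2 : ℂ)⁻¹ • (mean ∘ₗ Matrix.traceLinearMap (Fin 2) ℂ _)
  map_one' := by
    change (2 : ℂ)⁻¹ • mean (Matrix.trace 1) = 1
    rw [Matrix.trace_fin_two, map_add, Matrix.one_apply_eq, Matrix.one_apply_eq, mean_one]
    norm_num

theorem rayleighState_apply [Fintype ι] (A : Matrix (Fin 2) (Fin 2) (GaussianAlgebra ι)) :
    rayleighState A = (2 : ℂ)⁻¹ * (mean (A 0 0) + mean (A 1 1)) := by
  change (2 : ℂ)⁻¹ • mean A.trace = _
  rw [Matrix.trace_fin_two, map_add, smul_eq_mul]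

variable [DecidableEq ι]

theorem isSelfAdjoint_rayleighVar (j : ι) : IsSelfAdjoint (rayleighVar j) := by
  rw [isSelfAdjoint_iff, Matrix.star_eq_conjTranspose]
  ext a b
  fin_cases a <;> fin_cases b <;> simp [rayleighVar, star_var, star_varConj]

theorem halfCommute_rayleighVar : HalfCommute (rayleighVar : ι → _) := by
  intro i j k
  ext a b
  fin_cases a <;> fin_cases b <;> simp [rayleighVar, mul_comm, mul_left_comm]

theorem prod_rayleighVar (w : List ι) :
    (w.map rayleighVar).prod = if Even w.length
      then !![altProd var varConj w, 0; 0, altProd varConj var w]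
      else !![0, altProd var varConj w; altProd varConj var w, 0] := by
  induction w with
  | nil => simp [altProd, Matrix.one_fin_two]
  | cons i w ih =>
    rw [List.map_cons, List.prod_cons, ih, rayleighVar]
    simp only [List.length_cons, Nat.even_add_one, altProd]
    split_ifs <;> simp

variable [Fintype ι]

/-- The two diagonal entries of an even word differ by exchanging `z` and `conj z`, and the Gaussian
moments are symmetric under this; an odd word has zero diagonal. -/
theorem rayleighState_prod (w : List ι) :
    rayleighState (w.map rayleighVar).prod = if Even w.length
      then ∏ j, (gaussianMixedMoment (altCount j w).1 (altCount j w).2 : ℂ) else 0 := by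
  rw [prod_rayleighVar, rayleighState_apply]
  split_ifs
  · have h : altProd varConj var w = ∏ j : ι, var j ^ (altCount j w).2 *
        varConj j ^ (altCount j w).1 := by
      rw [altProd_eq_prod]
      exact Finset.prod_congr rfl fun j _ => mul_comm _ _
    simp only [Matrix.of_apply, Matrix.cons_val', Matrix.cons_val_zero, Matrix.cons_val_one,
      Matrix.cons_val_fin_one]
    rw [h, altProd_eq_prod, mean_prod_var_pow, mean_prod_var_pow]
    simp only [gaussianMixedMoment_comm (altCount _ w).2]
    ring
  · simp

theorem isSymmetrizedRayleigh_rayleighVar (j : ι) :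
    IsSymmetrizedRayleigh rayleighState (rayleighVar j) where
  selfAdjoint := isSelfAdjoint_rayleighVar j
  odd_moment m hm := by
    have h := rayleighState_prod (List.replicate (2 * m - 1) j)
    rw [List.map_replicate, List.prod_replicate, List.length_replicate, if_neg] at h
    · exact h
    · rw [Nat.not_even_iff_odd]; exact ⟨m - 1, by omega⟩
  even_moment m hm := by
    have h := rayleighState_prod (List.replicate (2 * m) j)
    rw [List.map_replicate, List.prod_replicate, List.length_replicate, if_pos (by simp)] at h
    rw [h, Finset.prod_eq_single j]
    · simp [altCount_replicate, gaussianMixedMoment]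
    · intro i _ hij
      simp [altCount_replicate, hij.symm, gaussianMixedMoment]
    · simp

omit [Fintype ι] in
theorem rayleighVar_sq (j : ι) :
    rayleighVar j ^ 2 = Matrix.scalar (Fin 2) (var j * varConj j : GaussianAlgebra ι) := by
  rw [sq, rayleighVar, Matrix.mul_fin_two]
  ext a b
  fin_cases a <;> fin_cases b <;> simp [mul_comm]

omit [DecidableEq ι] in
theorem rayleighState_scalar (x : GaussianAlgebra ι) :
    rayleighState (Matrix.scalar (Fin 2) x) = mean x := by
  rw [rayleighState_apply]
  simp
  ring

theorem mean_prod_sq {s : Finset ι} (r : ι → ℕ) :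
    mean (∏ j ∈ s, (var j * varConj j : GaussianAlgebra ι) ^ r j) =
      ∏ j ∈ s, ((r j).factorial : ℂ) := by
  have h := mean_prod_var_pow (fun j => if j ∈ s then r j else 0) fun j => if j ∈ s then r j else 0
  simp only [gaussianMixedMoment, if_true, ← mul_pow] at h
  rw [← Finset.prod_subset (Finset.subset_univ s), ← Finset.prod_subset (Finset.subset_univ s)] at h
  · convert h using 2
    · exact Finset.prod_congr rfl fun j hj => by rw [if_pos hj]
    · simp_all
  all_goals intro j _ hj; simp [hj]

/-- The squares are the scalar matrices `z_j * conj z_j`, so they commute and inherit the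
factorization of `mean`. In a non-symmetric word of even length some letter has unequal exponents of
`z_j` and `conj z_j`, and its Gaussian moment is zero. -/
theorem halfIndependent_rayleighVar : HalfIndependent rayleighState (rayleighVar : ι → _) where
  halfCommute := halfCommute_rayleighVar
  indep_sq :=
    { commute := fun i j => by
        rw [rayleighVar_sq, rayleighVar_sq]
        exact (Commute.all _ _).map _
      factorize := fun s hs p q => by
        have h : ∀ j, (rayleighVar j ^ 2) ^ p j * star (rayleighVar j ^ 2) ^ q j =
            Matrix.scalar (Fin 2) ((var j * varConj j : GaussianAlgebra ι) ^ (p j + q j)) := by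
          intro j
          rw [((isSelfAdjoint_rayleighVar j).pow 2).star_eq, ← pow_add, rayleighVar_sq, map_pow]
        have h1 : ∀ j, rayleighState ((rayleighVar j ^ 2) ^ p j * star (rayleighVar j ^ 2) ^ q j) =
            ((p j + q j).factorial : ℂ) := by
          intro j
          have := mean_prod_sq (s := {j}) fun j => p j + q j
          rw [h, rayleighState_scalar]
          simpa using this
        simp only [h1]
        simp only [h]
        have h2 : (s.map fun j => Matrix.scalar (Fin 2)
            ((var j * varConj j : GaussianAlgebra ι) ^ (p j + q j))).prod = Matrix.scalar (Fin 2)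
            (s.map fun j => (var j * varConj j : GaussianAlgebra ι) ^ (p j + q j)).prod := by
          rw [map_list_prod, List.map_map]; rfl
        rw [h2, rayleighState_scalar, ← List.prod_toFinset _ hs, ← List.prod_toFinset _ hs,
          mean_prod_sq] }
  nonsymmetric m w hw := by
    have e : (List.ofFn fun r => rayleighVar (w r)) = (List.ofFn w).map rayleighVar := by
      rw [List.map_ofFn]; rfl
    rw [e, rayleighState_prod]
    split_ifs
    · rw [isSymmetricWord_iff_altCount] at hw
      push Not at hw
      obtain ⟨j, hj⟩ := hw
      exact Finset.prod_eq_zero (Finset.mem_univ j) (by simp [gaussianMixedMoment, hj.symm])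
    · rfl

end Model

/-! ### The moments of random left skew-circulant matrices -/

theorem norm_prod_le_pow_card {ι : Type*} (S : Finset ι) {f : ι → ℂ} {R : ℝ}
    (hf : ∀ i, ‖f i‖ ≤ R) : ‖∏ i ∈ S, f i‖ ≤ R ^ S.card := by
  rw [norm_prod, ← Finset.prod_const]
  exact Finset.prod_le_prod (fun i _ => norm_nonneg _) fun i _ => hf i

theorem norm_prod_sub_prod_le_card_mul {ι : Type*} (S : Finset ι) {f g : ι → ℂ} {R ε : ℝ}
    (hR : 1 ≤ R) (hf : ∀ i, ‖f i‖ ≤ R) (hg : ∀ i, ‖g i‖ ≤ R) (hfg : ∀ i, ‖f i - g i‖ ≤ ε) :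
    ‖∏ i ∈ S, f i - ∏ i ∈ S, g i‖ ≤ S.card * R ^ S.card * ε := by
  classical
  induction S using Finset.induction_on with
  | empty => simp
  | insert i S hi ih =>
    have hε : 0 ≤ ε := (norm_nonneg _).trans (hfg i)
    rw [Finset.prod_insert hi, Finset.prod_insert hi, Finset.card_insert_of_notMem hi]
    have e : f i * ∏ j ∈ S, f j - g i * ∏ j ∈ S, g j =
        f i * (∏ j ∈ S, f j - ∏ j ∈ S, g j) + (f i - g i) * ∏ j ∈ S, g j := by ring
    rw [e]
    refine (norm_add_le _ _).trans ?_
    rw [norm_mul, norm_mul]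
    calc _ ≤ R * (S.card * R ^ S.card * ε) + ε * R ^ S.card := by
          gcongr
          exacts [hf i, hfg i, norm_prod_le_pow_card S hg]
      _ ≤ R * (S.card * R ^ S.card * ε) + ε * R ^ S.card * R := by
          exact add_le_add le_rfl (le_mul_of_one_le_right (by positivity) hR)
      _ = _ := by push_cast; ring

theorem AssumptionI.exists_boundedInputs {Ω : ℕ+ → Type*} [∀ n, MeasurableSpace (Ω n)]
    {P : ∀ n, Measure (Ω n)} [∀ n, IsProbabilityMeasure (P n)] {x : ∀ n : ℕ+, Fin n → Ω n → ℝ}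
    (h : AssumptionI P x) : ∃ C : ℕ → ℝ, ∀ n, BoundedInputs (P n) C (x n) := by
  choose C hC using h.bounded_moments
  refine ⟨C, fun n => ⟨h.measurable n, h.indep n, h.mean_zero n, fun i => ?_, fun i p hp => ?_,
    fun i p => (hC p n i).2⟩⟩
  · rw [← h.unit_variance n i, variance_of_integral_eq_zero (h.measurable n i).aemeasurable
      (h.mean_zero n i)]
  · have hm := (h.mem_momentAlgebra n i p hp).re
    simpa using hm

section RandomSkewCirculant

variable {Ω : Type*} [MeasurableSpace Ω] (P : Measure Ω) [IsProbabilityMeasure P]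

/-- Evaluation of random variables at a point of the probability space. -/
noncomputable def momentEval (ω : Ω) : momentAlgebra P →+* ℂ :=
  (Pi.evalRingHom (fun _ : Ω => ℂ) ω).comp (momentAlgebra P).subtype.toAlgHom.toRingHom

theorem momentEval_apply (ω : Ω) (f : momentAlgebra P) : momentEval P ω f = (f : Ω → ℂ) ω := rfl

theorem expectedTrace_apply (n : ℕ+) (A : RandomMatrix P n) :
    expectedTrace P n A =
      ((n : ℕ) : ℂ)⁻¹ * ∫ ω, Matrix.trace ((momentEval P ω).mapMatrix A) ∂P := by
  change ((n : ℕ) : ℂ)⁻¹ • expectation P (Matrix.trace A) = _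
  rw [smul_eq_mul]
  congr 1
  refine integral_congr_ae (Eventually.of_forall fun ω => ?_)
  change momentEval P ω A.trace = _
  exact AddMonoidHom.map_trace (momentEval P ω) A

end RandomSkewCirculant

section Convergence

variable {Ω : ℕ+ → Type*} [∀ n, MeasurableSpace (Ω n)] {P : ∀ n, Measure (Ω n)}
  [∀ n, IsProbabilityMeasure (P n)]

/-- The matrix is real and symmetric, so adjoints in a monomial can be dropped. -/
theorem AssumptionI.star_smul_leftSkewCirculant {x : ∀ n : ℕ+, Fin n → Ω n → ℝ}
    (h : AssumptionI P x) (n : ℕ+) (r : ℝ) :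
    star ((r : ℂ) • h.leftSkewCirculant n) = (r : ℂ) • h.leftSkewCirculant n := by
  rw [star_smul]
  congr 1
  · simp
  · rw [Matrix.star_eq_conjTranspose, Matrix.conjTranspose, AssumptionI.leftSkewCirculant,
      leftSkewCirculant_isSymm]
    ext i j ω
    simp only [_root_.leftSkewCirculant, Matrix.map_apply, Matrix.of_apply]
    split_ifs <;> simp

theorem AssumptionI.mapMatrix_smul_leftSkewCirculant {x : ∀ n : ℕ+, Fin n → Ω n → ℝ}
    (h : AssumptionI P x) (n : ℕ+) (r : ℝ) (ω : Ω n) :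
    (momentEval (P n) ω).mapMatrix ((r : ℂ) • h.leftSkewCirculant n) =
      _root_.leftSkewCirculant fun i => (r : ℂ) * x n i ω := by
  ext i j
  simp only [RingHom.mapMatrix_apply, Matrix.map_apply, Matrix.smul_apply, momentEval_apply,
    AssumptionI.leftSkewCirculant, _root_.leftSkewCirculant, Matrix.of_apply]
  split_ifs <;> simp

variable {k : ℕ} {l : Fin k → ∀ n : ℕ+, Fin n → Ω n → ℝ}

omit [∀ n, IsProbabilityMeasure (P n)] in
theorem integral_altProd_eq_prod {n : ℕ+}
    (hl : ∀ j, AssumptionI P (l j))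
    (hindep : iIndepFun (fun (j : Fin k) (ω : Ω n) (i : Fin n) => l j n i ω) (P n))
    (c : Fin n → ℂ) (w : List (Fin k)) :
    ∫ ω, altProd (fun j => weightedSum c (l j n) Finset.univ ω)
      (fun j => conj (weightedSum c (l j n) Finset.univ ω)) w ∂(P n) =
    ∏ j, ∫ ω, mixedPow (altCount j w).1 (altCount j w).2
      (weightedSum c (l j n) Finset.univ ω) ∂(P n) := by
  simp only [altProd_eq_prod]
  have hm : ∀ j, Measurable fun y : Fin n → ℝ =>
      mixedPow (altCount j w).1 (altCount j w).2 (∑ i, c i * (y i : ℂ)) := fun j =>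
    (measurable_mixedPow _ _).comp (by fun_prop)
  exact hindep.integral_fun_prod_comp
    (fun j => (measurable_pi_lambda _ ((hl j).measurable n)).aemeasurable)
    fun j => (hm j).aestronglyMeasurable

/-- The deterministic trace formula is applied at each `ω` with `b = conj a`; real inputs make the
two eigenvalue sums conjugate, and independence over `j` splits the expectation. -/
theorem expectedTrace_evalStarMonomial {n : ℕ+} (hl : ∀ j, AssumptionI P (l j))
    (hindep : iIndepFun (fun (j : Fin k) (ω : Ω n) (i : Fin n) => l j n i ω) (P n))
    {a : Fin n → ℂ} (hinj : Function.Injective a) (ha : ∀ t, a t ^ (n : ℕ) = -1)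
    (hnorm : ∀ t, ‖a t‖ = 1) (r : ℝ) (Q : List (Fin k × Bool)) :
    expectedTrace (P n) n
        (evalStarMonomial (fun j => (r : ℂ) • (hl j).leftSkewCirculant n) Q) =
      ((n : ℕ) : ℂ)⁻¹ * ∑ t, if Even (Q.map Prod.fst).length ∨ a t ^ 2 = 1 then
        ∏ j, ∫ ω, mixedPow (altCount j (Q.map Prod.fst)).1 (altCount j (Q.map Prod.fst)).2
          (weightedSum (fun s : Fin n => (r : ℂ) * a t ^ (s : ℕ)) (l j n) Finset.univ ω) ∂(P n)
        else 0 := by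
  set w := Q.map Prod.fst with hw
  have e1 : evalStarMonomial (fun j => (r : ℂ) • (hl j).leftSkewCirculant n) Q =
      (w.map fun j => (r : ℂ) • (hl j).leftSkewCirculant n).prod := by
    simp only [evalStarMonomial, AssumptionI.star_smul_leftSkewCirculant, ite_self, hw,
      List.map_map]
    rfl
  have hconj : ∀ t, a t * conj (a t) = 1 := fun t => by
    rw [Complex.mul_conj, Complex.normSq_eq_norm_sq, hnorm]; simp
  have e2 : ∀ ω, Matrix.trace ((momentEval (P n) ω).mapMatrix
      (w.map fun j => (r : ℂ) • (hl j).leftSkewCirculant n).prod) =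
      ∑ t, if Even w.length ∨ a t ^ 2 = 1 then
        altProd (fun j => weightedSum (fun s : Fin n => (r : ℂ) * a t ^ (s : ℕ)) (l j n)
            Finset.univ ω)
          (fun j => conj (weightedSum (fun s : Fin n => (r : ℂ) * a t ^ (s : ℕ)) (l j n)
            Finset.univ ω)) w else 0 := by
    intro ω
    rw [map_list_prod, List.map_map]
    have e3 : (⇑(momentEval (P n) ω).mapMatrix ∘
        fun j => (r : ℂ) • (hl j).leftSkewCirculant n) =
        fun j => leftSkewCirculant fun i => (r : ℂ) * l j n i ω :=
      funext fun j => (hl j).mapMatrix_smul_leftSkewCirculant n r ω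
    rw [e3, trace_prod_leftSkewCirculant (fun j i => (r : ℂ) * l j n i ω) hconj ha hinj]
    have e4 : ∀ t j, ∑ s, (r : ℂ) * l j n s ω * a t ^ (s : ℕ) =
        weightedSum (fun s : Fin n => (r : ℂ) * a t ^ (s : ℕ)) (l j n) Finset.univ ω :=
      fun t j => Finset.sum_congr rfl fun s _ => by ring
    have e5 : ∀ t j, ∑ s, (r : ℂ) * l j n s ω * conj (a t) ^ (s : ℕ) =
        conj (weightedSum (fun s : Fin n => (r : ℂ) * a t ^ (s : ℕ)) (l j n) Finset.univ ω) :=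
      fun t j => by
        rw [← e4, map_sum]
        exact Finset.sum_congr rfl fun s _ => by simp
    simp only [e4, e5]
  have hint : ∀ c : Fin n → ℂ, Integrable (fun ω =>
      altProd (fun j => weightedSum c (l j n) Finset.univ ω)
        (fun j => conj (weightedSum c (l j n) Finset.univ ω)) w) (P n) := by
    intro c
    refine HasAllMoments.integrable ?_
    have hX : ∀ j, HasAllMoments (weightedSum c (l j n) Finset.univ) (P n) := fun j => by
      obtain ⟨C, hC⟩ := (hl j).exists_boundedInputs
      exact (hC n).hasAllMoments_weightedSum _
    -- Both families are quantified because each letter exchanges their roles.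
    have : ∀ z z' : Fin k → Ω n → ℂ, (∀ j, HasAllMoments (z j) (P n)) →
        (∀ j, HasAllMoments (z' j) (P n)) →
        HasAllMoments (fun ω => altProd (fun j => z j ω) (fun j => z' j ω) w) (P n) := by
      clear_value w
      clear hw e1 e2
      induction w with
      | nil => exact fun _ _ _ _ => HasAllMoments.const 1
      | cons i w ih => exact fun z z' hz hz' => (hz i).mul (ih z' z hz' hz)
    exact this _ _ hX fun j => (hX j).conjugate
  rw [e1, expectedTrace_apply]
  simp only [e2]
  congr 1
  rw [integral_finsetSum]
  · refine Finset.sum_congr rfl fun t _ => ?_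
    split_ifs
    · exact integral_altProd_eq_prod hl hindep _ w
    · simp
  · intro t _
    split_ifs
    · exact hint _
    · exact integrable_zero _ _ _

/-- The contribution of one eigenvector to the moments: it is bounded, and close to the Gaussian
moment unless the eigenvalue is real. -/
theorem exists_norm_prod_integral_mixedPow_bounds (hl : ∀ j, AssumptionI P (l j))
    (p q : Fin k → ℕ) :
    ∃ K : ℝ, 0 ≤ K ∧ ∀ (n : ℕ+) (a : ℂ), ‖a‖ = 1 → a ^ (n : ℕ) = -1 →
      ‖∏ j, ∫ ω, mixedPow (p j) (q j) (weightedSum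
        (fun s : Fin n => (((Real.sqrt (n : ℕ))⁻¹ : ℝ) : ℂ) * a ^ (s : ℕ)) (l j n)
          Finset.univ ω) ∂(P n)‖ ≤ K ∧
      (a ^ 2 ≠ 1 → ‖∏ j, ∫ ω, mixedPow (p j) (q j) (weightedSum
        (fun s : Fin n => (((Real.sqrt (n : ℕ))⁻¹ : ℝ) : ℂ) * a ^ (s : ℕ)) (l j n)
          Finset.univ ω) ∂(P n) - ∏ j, (gaussianMixedMoment (p j) (q j) : ℂ)‖ ≤
        K * (Real.sqrt (n : ℕ))⁻¹) := by
  choose C hC using fun j => (hl j).exists_boundedInputs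
  choose K hK0 hK using fun j =>
    exists_norm_integral_mixedPow_sub_gaussian_le (C j) (p j) (q j)
  -- A common bound, at least `1`, for all the moments and their Gaussian limits, as the telescoping
  -- estimate for products requires.
  set R : ℝ := 1 + ∑ j, (sumMomentBound (C j) (p j + q j) + gaussianMixedMoment (p j) (q j))
    with hR
  have hterm : ∀ j, 0 ≤ sumMomentBound (C j) (p j + q j) + gaussianMixedMoment (p j) (q j) :=
    fun j => add_nonneg (sumMomentBound_nonneg _ _) (Nat.cast_nonneg _)
  have hR1 : 1 ≤ R := le_add_of_nonneg_right (Finset.sum_nonneg fun j _ => hterm j)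
  have hRj : ∀ j, sumMomentBound (C j) (p j + q j) + gaussianMixedMoment (p j) (q j) ≤ R :=
    fun j => (Finset.single_le_sum (fun j _ => hterm j) (Finset.mem_univ j)).trans
      (le_add_of_nonneg_left zero_le_one)
  have hKs : 0 ≤ ∑ j, K j := Finset.sum_nonneg fun j _ => hK0 j
  refine ⟨R ^ k + k * R ^ k * ∑ j, K j, by positivity, fun n a hnorm ha => ?_⟩
  set δ : ℝ := (Real.sqrt (n : ℕ))⁻¹ with hδ
  have hn : (0 : ℝ) < (n : ℕ) := by exact_mod_cast n.pos
  have hn1 : (1 : ℝ) ≤ (n : ℕ) := by exact_mod_cast n.pos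
  have hδ0 : 0 ≤ δ := by positivity
  have hδ1 : δ ≤ 1 := inv_le_one_of_one_le₀ (Real.one_le_sqrt.2 hn1)
  have hδ2 : δ ^ 2 = ((n : ℕ) : ℝ)⁻¹ := by rw [hδ, inv_pow, Real.sq_sqrt hn.le]
  have hδn : ((n : ℕ) : ℝ) * δ ^ 2 = 1 := by rw [hδ2, mul_inv_cancel₀ hn.ne']
  set c : Fin n → ℂ := fun s => (δ : ℂ) * a ^ (s : ℕ) with hc
  have hcn : ∀ s, ‖c s‖ ≤ δ := fun s => by
    rw [hc, norm_mul, norm_pow, hnorm, one_pow, mul_one, Complex.norm_real,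
      Real.norm_of_nonneg hδ0]
  have hcard : (Fintype.card (Fin n) : ℝ) * δ ^ 2 ≤ 1 := by rw [Fintype.card_fin, hδn]
  have hf : ∀ j, ‖∫ ω, mixedPow (p j) (q j) (weightedSum c (l j n) Finset.univ ω) ∂(P n)‖ ≤ R :=
    fun j => ((hC j n).norm_integral_mixedPow_le hδ1 hcn hcard _ _).trans
      ((le_add_of_nonneg_right (Nat.cast_nonneg _)).trans (hRj j))
  have hg : ∀ j, ‖(gaussianMixedMoment (p j) (q j) : ℂ)‖ ≤ R := fun j => by
    rw [Complex.norm_natCast]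
    exact (le_add_of_nonneg_left (sumMomentBound_nonneg _ _)).trans (hRj j)
  constructor
  · refine (norm_prod_le_pow_card _ hf).trans ?_
    rw [Finset.card_univ, Fintype.card_fin]
    exact le_add_of_nonneg_right (by positivity)
  · intro ha2
    -- A geometric sum with ratio `a ^ 2 ≠ 1`, whose `n`-th power is `1`.
    have h1 : ∑ s, c s ^ 2 = 0 := by
      have e : ∀ s, c s ^ 2 = (δ : ℂ) ^ 2 * (a ^ 2) ^ (s : ℕ) := fun s => by
        rw [hc]; ring
      simp only [e, ← Finset.mul_sum]
      rw [geom_sum_of_pow_eq_one (by rw [← pow_mul, mul_comm, pow_mul, ha]; ring), if_neg ha2,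
        mul_zero]
    have h2 : ∑ s, c s * conj (c s) = 1 := by
      have e : ∀ s, c s * conj (c s) = ((δ ^ 2 : ℝ) : ℂ) := fun s => by
        rw [Complex.mul_conj, Complex.normSq_eq_norm_sq, hc, norm_mul, norm_pow, hnorm, one_pow,
          mul_one, Complex.norm_real, Real.norm_of_nonneg hδ0]
      simp only [e, Finset.sum_const, Finset.card_univ, Fintype.card_fin, nsmul_eq_mul]
      exact_mod_cast hδn
    have hfg : ∀ j, ‖∫ ω, mixedPow (p j) (q j) (weightedSum c (l j n) Finset.univ ω) ∂(P n) -
        gaussianMixedMoment (p j) (q j)‖ ≤ (∑ j, K j) * δ := fun j =>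
      (hK j (hC j n) hδ0 hδ1 hcn hcard h1 h2).trans (by
        gcongr
        exact Finset.single_le_sum (fun j _ => hK0 j) (Finset.mem_univ j))
    refine (norm_prod_sub_prod_le_card_mul Finset.univ hR1 hf hg hfg).trans ?_
    rw [Finset.card_univ, Fintype.card_fin, ← mul_assoc]
    gcongr
    exact le_add_of_nonneg_left (by positivity)

/-- Every root other than `-1` has error at most `K / √n`. The root `-1`, if present, has error at
most `K' = K + ‖g‖`, which contributes `K' / n` to the average. -/
theorem tendsto_expectedTrace_evalStarMonomial (hl : ∀ j, AssumptionI P (l j))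
    (hindep : ∀ n, iIndepFun (fun (j : Fin k) (ω : Ω n) (i : Fin n) => l j n i ω) (P n))
    (Q : List (Fin k × Bool)) :
    Tendsto (fun n => expectedTrace (P n) n (evalStarMonomial
      (fun j => (((Real.sqrt (n : ℕ))⁻¹ : ℝ) : ℂ) • (hl j).leftSkewCirculant n) Q)) atTop
      (𝓝 (if Even (Q.map Prod.fst).length then ∏ j, (gaussianMixedMoment
        (altCount j (Q.map Prod.fst)).1 (altCount j (Q.map Prod.fst)).2 : ℂ) else 0)) := by
  set w := Q.map Prod.fst with hw
  set g : ℂ := ∏ j, (gaussianMixedMoment (altCount j w).1 (altCount j w).2 : ℂ) with hg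
  obtain ⟨K, hK0, hK⟩ := exists_norm_prod_integral_mixedPow_bounds hl
    (fun j => (altCount j w).1) fun j => (altCount j w).2
  set K' := K + ‖g‖
  have hK' : 0 ≤ K' := by positivity
  have hval : Tendsto (fun n : ℕ+ => ((n : ℕ) : ℝ)) atTop atTop :=
    tendsto_natCast_atTop_atTop.comp tendsto_PNat_val_atTop_atTop
  have hlim : Tendsto (fun n : ℕ+ => K * (Real.sqrt (n : ℕ))⁻¹ + K' * ((n : ℕ) : ℝ)⁻¹) atTop
      (𝓝 0) := by
    have h1 := (tendsto_inv_atTop_zero.comp (Real.tendsto_sqrt_atTop.comp hval)).const_mul K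
    have h2 := (tendsto_inv_atTop_zero.comp hval).const_mul K'
    simpa using h1.add h2
  refine tendsto_iff_norm_sub_tendsto_zero.2 (squeeze_zero (fun _ => norm_nonneg _)
    (fun n => ?_) hlim)
  obtain ⟨a, hinj, ha, hnorm⟩ := exists_injective_pow_eq_neg_one (n : ℕ)
  have hn : ((n : ℕ) : ℂ) ≠ 0 := by simp
  have hn' : ((n : ℕ) : ℝ) ≠ 0 := by simp
  rw [expectedTrace_evalStarMonomial hl (hindep n) hinj ha hnorm, ← hw]
  set m : Fin n → ℂ := fun t => ∏ j, ∫ ω, mixedPow (altCount j w).1 (altCount j w).2 (weightedSum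
    (fun s : Fin n => (((Real.sqrt (n : ℕ))⁻¹ : ℝ) : ℂ) * a t ^ (s : ℕ)) (l j n)
      Finset.univ ω) ∂(P n) with hm
  set g' : ℂ := if Even w.length then g else 0 with hg'
  have hg'g : ‖g'‖ ≤ ‖g‖ := by rw [hg']; split_ifs <;> simp
  have e : ((n : ℕ) : ℂ)⁻¹ * (∑ t, if Even w.length ∨ a t ^ 2 = 1 then m t else 0) - g' =
      ((n : ℕ) : ℂ)⁻¹ * ∑ t, ((if Even w.length ∨ a t ^ 2 = 1 then m t else 0) - g') := by
    rw [Finset.sum_sub_distrib, mul_sub, Finset.sum_const, Finset.card_univ, Fintype.card_fin,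
      nsmul_eq_mul, inv_mul_cancel_left₀ hn]
  have hterm : ∀ t, ‖(if Even w.length ∨ a t ^ 2 = 1 then m t else 0) - g'‖ ≤
      K * (Real.sqrt (n : ℕ))⁻¹ + if a t = -1 then K' else 0 := by
    intro t
    obtain ⟨h1, h2⟩ := hK n (a t) (hnorm t) (ha t)
    have h0 : 0 ≤ K * (Real.sqrt (n : ℕ))⁻¹ := by positivity
    by_cases hr : a t ^ 2 = 1
    · have hr' : a t = -1 := by
        rcases mul_self_eq_one_iff.1 ((sq _).symm.trans hr) with h | h
        · have := ha t
          rw [h, one_pow] at this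
          norm_num at this
        · exact h
      rw [if_pos (Or.inr hr), if_pos hr']
      exact (norm_sub_le _ _).trans ((add_le_add h1 hg'g).trans (le_add_of_nonneg_left h0))
    · have hr' : a t ≠ -1 := fun h => hr (by rw [h]; norm_num)
      rw [if_neg hr', add_zero]
      by_cases hev : Even w.length
      · rw [if_pos (Or.inl hev), hg', if_pos hev]
        exact h2 hr
      · rw [if_neg (by tauto), hg', if_neg hev]
        simpa using h0
  have hone : ∑ t, (if a t = -1 then K' else 0) ≤ K' := by
    rw [← Finset.sum_filter, Finset.sum_const, nsmul_eq_mul]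
    refine mul_le_of_le_one_left hK' ?_
    norm_cast
    refine Finset.card_le_one.2 fun t ht t' ht' => hinj ?_
    rw [(Finset.mem_filter.1 ht).2, (Finset.mem_filter.1 ht').2]
  rw [e, norm_mul, norm_inv, Complex.norm_natCast]
  calc _ ≤ ((n : ℕ) : ℝ)⁻¹ * ∑ t : Fin n, (K * (Real.sqrt (n : ℕ))⁻¹ +
        if a t = -1 then K' else 0) := by
        gcongr
        exact norm_sum_le_of_le _ fun t _ => hterm t
    _ ≤ ((n : ℕ) : ℝ)⁻¹ * ((n : ℕ) * (K * (Real.sqrt (n : ℕ))⁻¹) + K') := by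
        rw [Finset.sum_add_distrib, Finset.sum_const, Finset.card_univ, Fintype.card_fin,
          nsmul_eq_mul]
        gcongr
    _ = _ := by field_simp

end Convergence

theorem mainTheorem9 {Ω : ℕ+ → Type*} [∀ n, MeasurableSpace (Ω n)] (P : ∀ n, Measure (Ω n))
    [∀ n, IsProbabilityMeasure (P n)] (k : ℕ)
    (l : Fin k → ∀ n : ℕ+, Fin n → Ω n → ℝ)
    (hl : ∀ j, AssumptionI P (l j))
    (hindep : ∀ n, iIndepFun (fun (j : Fin k) (ω : Ω n) (i : Fin n) => l j n i ω) (P n)) :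
    ∃ (A : Type) (_ : Ring A) (_ : StarRing A) (_ : Algebra ℂ A) (_ : StarModule ℂ A)
      (φ : NCState A) (a : Fin k → A),
      (∀ j, IsSymmetrizedRayleigh φ (a j)) ∧ HalfIndependent φ a ∧
      ConvergesInStarDistribution (fun n => expectedTrace (P n) n)
        (fun n j => (((Real.sqrt (n : ℕ))⁻¹ : ℝ) : ℂ) • (hl j).leftSkewCirculant n) φ a := by
  refine ⟨Matrix (Fin 2) (Fin 2) (GaussianAlgebra (Fin k)), inferInstance, inferInstance,
    inferInstance, inferInstance, rayleighState, rayleighVar, isSymmetrizedRayleigh_rayleighVar,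
    halfIndependent_rayleighVar, fun Q => ?_⟩
  have e : evalStarMonomial (rayleighVar (ι := Fin k)) Q =
      ((Q.map Prod.fst).map rayleighVar).prod := by
    simp only [evalStarMonomial, (isSelfAdjoint_rayleighVar _).star_eq, ite_self, List.map_map]
    rfl
  rw [e, rayleighState_prod]
  exact tendsto_expectedTrace_evalStarMonomial hl hindep Q
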